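/- Let $D\subset\mathbb C$ be an unbounded domain whose boundary consists of (countably many) piecewise smooth curves and whose complement is unbounded, and let $f$ be a complex-valued function whose domain of definition contains $\overline D$. Suppose that $D$ is a logarithmic tract of $f$, that is, $f$ is holomorphic in $D$ and continuous in $\overline D$, and there exists $R>0$ such that $f:D\to\{w\in\mathbb C:|w|>R\}$ is a universal covering. Let $q$ be a real number and suppose that for each $\varepsilon>0$ there exists $r_\varepsilon>0$ such that \[ |f(z)|\le \exp\left(\exp\left((\log|z|)^{q+\varepsilon}\right)\right)\quad\text{for all } z\in D \text{ with } |z|\ge r_\varepsilon . \] (This can only happen if $q\ge 1$.) Let \[ I(f,D)=\{z\in D: f^n(z)\in D\text{ for all } n\in\mathbb N\text{ and } f^n(z)\to\infty\text{ as } n\to\infty\}. \] Then the Hausdorff dimension of $I(f,D)$ satisfies \[ \dim I(f,D)\ge 1+\frac1q . \] -/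

import Mathlib

open Set Filter Topology MeasureTheory

/-- The set `C` is a (regular) piecewise smooth curve in the plane: the image of a nondegenerate
interval `I` (of any kind, bounded or not) under a continuous map `γ` which, away from a locally
finite set `B` of break points, is continuously differentiable with nonvanishing derivative; at
the break points the one-sided derivatives have to exist, to be one-sided limits of the
derivative and to be nonzero. -/
def IsPiecewiseSmoothCurve (C : Set ℂ) : Prop :=
  ∃ (I : Set ℝ) (γ : ℝ → ℂ) (B : Set ℝ),
    I.OrdConnected ∧ I.Nontrivial ∧ ContinuousOn γ I ∧ γ '' I = C ∧
    (∀ a b : ℝ, (B ∩ Icc a b).Finite) ∧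
    (∀ a b : ℝ, a < b → Icc a b ⊆ I → Disjoint B (Ioo a b) →
      ContDiffOn ℝ 1 γ (Icc a b) ∧ ∀ t ∈ Icc a b, derivWithin γ (Icc a b) t ≠ 0)

/-- `f` is a universal covering of `D` onto `Ω`: it maps `D` onto `Ω`, the restriction `D → Ω` is
a covering map, and `D` is simply connected. -/
def IsUniversalCoveringOnto (f : ℂ → ℂ) (D Ω : Set ℂ) : Prop :=
  IsSimplyConnected D ∧ f '' D = Ω ∧
    ∃ h : MapsTo f D Ω, IsCoveringMap (h.restrict f D Ω)

/-- `D` is a logarithmic tract of `f`. Only the values of `f` on `closure D` matter; the values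
of the total function `f` elsewhere are irrelevant. -/
structure IsLogarithmicTract (f : ℂ → ℂ) (D : Set ℂ) : Prop where
  isOpen : IsOpen D
  isConnected : IsConnected D
  unbounded : ¬ Bornology.IsBounded D
  unbounded_compl : ¬ Bornology.IsBounded Dᶜ
  /-- The boundary consists of (countably many) piecewise smooth curves. -/
  frontier_eq : ∃ 𝒞 : Set (Set ℂ), 𝒞.Countable ∧ (∀ C ∈ 𝒞, IsPiecewiseSmoothCurve C) ∧
    frontier D = ⋃₀ 𝒞
  holomorphic : DifferentiableOn ℂ f D
  continuousOn : ContinuousOn f (closure D)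
  covering : ∃ R : ℝ, 0 < R ∧ IsUniversalCoveringOnto f D {w : ℂ | R < ‖w‖}

/-- The set `I(f, D)` of points of `D` whose orbit stays in `D` and tends to infinity. -/
def escapingSetIn (f : ℂ → ℂ) (D : Set ℂ) : Set ℂ :=
  {z | z ∈ D ∧ (∀ n : ℕ, f^[n] z ∈ D) ∧ Tendsto (fun n : ℕ => ‖f^[n] z‖) atTop atTop}

/-! Pass to logarithmic coordinates. Since `D` is a logarithmic tract, `exp` on a half-plane `Re w >
a` lifts through `f` to an injective holomorphic map `exp ∘ g` into `D` with `f (exp (g w)) = exp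
w`. If `w 0, w 1, ...` satisfies `w n = g (w (n + 1)) + 2πik` with integers `k` depending on `n`,
and `Re (w n) → ∞`, then `exp (w 0)` lies in `I(f, D)`. It suffices to find a set of such starting
points of dimension at least `s`, for each `s` in `(1, 1 + 1/q)`, because `exp` does not lower
dimension. Choose `p > q` with `p (s - 1) < 1`.

Two facts about `g` are used. The growth bound gives `Re g(x) ≥ (log x)^(1/p)`. Injectivity of `exp
∘ g` gives `|g'(x)| x ≤ 1344` and bounded distortion on discs of radius comparable to `x` (crude
Bloch and Koebe theorems). Consider a disc with centre `X` and radius `ρ`, and put `Λ = (2X)^p`. As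
`L` runs up to `Λ`, the function `Re g(e^L)` climbs through `[X - ρ/2, X + ρ/2]`, so a pigeonhole
argument finds about `Λ` points with values spaced by about `ρ/Λ` and slope at least `ρ/(4Λ)`
(`exists_steep_points`). Around each `x = e^L` the child disc is chosen so that its image has size
about `ρ/Λ`, independently of `|g'(x)|`; about `ρ` vertical translates by multiples of `2π` fit.
Thus there are about `Λρ` children with images of size `ρ/Λ`, which supports dimension `s` when `ρ ≥
C Λ^(s-1)`. This condition passes to the children: `x` is exponentially large in `X`, and the child
radius is at least a constant times `ρx/Λ`, which beats `x^(p(s-1))` (`IsTractLog.exists_children`).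

The dimension bound for the resulting tree is the mass distribution principle for the uniform
measure on addresses (`DiscTree.le_dimH_limitSet`). -/

/-! ### Trees of discs and the mass distribution principle. -/

/-- A tree of closed discs: every node `σ` carries the disc with centre `center σ` and radius
`radius σ`, which contains the images of the discs of its children `child σ i`, `i < num σ`, under
the maps `map σ i`. -/
structure DiscTree (S : Type*) where
  center : S → ℂ
  radius : S → ℝ
  num : S → ℕ
  child : S → ℕ → S
  map : S → ℕ → ℂ → ℂ
  radius_pos : ∀ σ, 0 < radius σ
  two_le_num : ∀ σ, 2 ≤ num σ
  measurable_map : ∀ σ i, Measurable (map σ i)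
  mapsTo : ∀ σ i, i < num σ →
    MapsTo (map σ i) (Metric.closedBall (center (child σ i)) (radius (child σ i)))
      (Metric.closedBall (center σ) (radius σ))
  lipschitz : ∀ σ i, i < num σ → ∃ L : ℝ, 0 ≤ L ∧ L * radius (child σ i) ≤ radius σ / 2 ∧
    ∀ w ∈ Metric.closedBall (center (child σ i)) (radius (child σ i)),
    ∀ w' ∈ Metric.closedBall (center (child σ i)) (radius (child σ i)),
      ‖map σ i w - map σ i w'‖ ≤ L * ‖w - w'‖

namespace DiscTree

variable {S : Type*} (T : DiscTree S)

/-- The disc of a node. -/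
def disc (σ : S) : Set ℂ := Metric.closedBall (T.center σ) (T.radius σ)

/-- The points of the disc of `σ` having an infinite backward itinerary through the tree. -/
def limitSet (σ : S) : Set ℂ :=
  {z | ∃ (τ : ℕ → S) (i : ℕ → ℕ) (w : ℕ → ℂ), τ 0 = σ ∧ w 0 = z ∧
    ∀ n, i n < T.num (τ n) ∧ τ (n + 1) = T.child (τ n) (i n) ∧ w n ∈ T.disc (τ n) ∧
      w n = T.map (τ n) (i n) (w (n + 1))}

/-- The first digit of a real number with respect to the children of `σ`. -/
noncomputable def digit (σ : S) (ω : ℝ) : ℕ := min ⌊(T.num σ : ℝ) * ω⌋₊ (T.num σ - 1)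

/-- The node reached by following the first digit. -/
noncomputable def next (σ : S) (ω : ℝ) : S := T.child σ (T.digit σ ω)

/-- The real number that remains when the first digit is dropped. -/
noncomputable def shift (σ : S) (ω : ℝ) : ℝ := Int.fract ((T.num σ : ℝ) * ω)

/-- Approximations of the point with a given address. -/
noncomputable def approx : ℕ → S → ℝ → ℂ
  | 0, σ, _ => T.center σ
  | n + 1, σ, ω => T.map σ (T.digit σ ω) (approx n (T.next σ ω) (T.shift σ ω))

/-- The cap in `digit` makes this true for every real `ω`, so addresses need not be restricted to
`[0, 1)` until measures enter. -/
lemma digit_lt (σ : S) (ω : ℝ) : T.digit σ ω < T.num σ := by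
  have := T.two_le_num σ
  unfold digit
  omega

lemma approx_mem (n : ℕ) (σ : S) (ω : ℝ) : T.approx n σ ω ∈ T.disc σ := by
  induction n generalizing σ ω with
  | zero => exact Metric.mem_closedBall_self (T.radius_pos σ).le
  | succ n ih => exact T.mapsTo σ _ (T.digit_lt σ ω) (ih _ _)

lemma measurable_approx (n : ℕ) (σ : S) : Measurable (T.approx n σ) := by
  induction n generalizing σ with
  | zero => exact measurable_const
  | succ n ih =>
    have hd : Measurable (T.digit σ) :=
      (Nat.measurable_floor.comp (measurable_const.mul measurable_id)).min measurable_const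
    have hs : Measurable (T.shift σ) :=
      measurable_fract.comp (measurable_const.mul measurable_id)
    have hF : Measurable fun x : ℕ × ℝ => T.map σ x.1 (T.approx n (T.child σ x.1) x.2) :=
      measurable_from_prod_countable_right fun i => (T.measurable_map σ i).comp (ih (T.child σ i))
    exact hF.comp (hd.prodMk hs)

/-- Distances relative to the radius of the disc are halved at each level. The radii of deeper discs
may tend to infinity, but they cancel along the way. -/
lemma norm_approx_succ_sub_le (n : ℕ) (σ : S) (ω : ℝ) :
    ‖T.approx (n + 1) σ ω - T.approx n σ ω‖ ≤ T.radius σ * (1 / 2) ^ n := by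
  induction n generalizing σ ω with
  | zero =>
    have := T.approx_mem 1 σ ω
    rw [disc, mem_closedBall_iff_norm] at this
    simpa [approx] using this
  | succ n ih =>
    obtain ⟨L, hL0, hL, hl⟩ := T.lipschitz σ _ (T.digit_lt σ ω)
    refine (hl _ (T.approx_mem (n + 1) _ _) _ (T.approx_mem n _ _)).trans ?_
    calc L * ‖T.approx (n + 1) (T.next σ ω) (T.shift σ ω) -
          T.approx n (T.next σ ω) (T.shift σ ω)‖
        ≤ L * (T.radius (T.next σ ω) * (1 / 2) ^ n) := by gcongr; exact ih _ _
      _ = (L * T.radius (T.next σ ω)) * (1 / 2) ^ n := by ring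
      _ ≤ (T.radius σ / 2) * (1 / 2) ^ n := by gcongr; exact hL
      _ = T.radius σ * (1 / 2) ^ (n + 1) := by ring

lemma exists_tendsto_approx (σ : S) (ω : ℝ) :
    ∃ z, Tendsto (fun n => T.approx n σ ω) atTop (𝓝 z) := by
  refine cauchySeq_tendsto_of_complete
    (cauchySeq_of_le_geometric (1 / 2) (T.radius σ) (by norm_num) fun n => ?_)
  rw [dist_comm, dist_eq_norm]
  exact T.norm_approx_succ_sub_le n σ ω

/-- The point of the limit set with a given address. -/
noncomputable def point (σ : S) (ω : ℝ) : ℂ := (T.exists_tendsto_approx σ ω).choose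

lemma tendsto_approx (σ : S) (ω : ℝ) :
    Tendsto (fun n => T.approx n σ ω) atTop (𝓝 (T.point σ ω)) :=
  (T.exists_tendsto_approx σ ω).choose_spec

lemma point_mem (σ : S) (ω : ℝ) : T.point σ ω ∈ T.disc σ :=
  Metric.isClosed_closedBall.mem_of_tendsto (T.tendsto_approx σ ω)
    (Eventually.of_forall fun n => T.approx_mem n σ ω)

lemma measurable_point (σ : S) : Measurable (T.point σ) :=
  measurable_of_tendsto_metrizable (fun n => T.measurable_approx n σ)
    (tendsto_pi_nhds.2 fun ω => T.tendsto_approx σ ω)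

lemma point_eq (σ : S) (ω : ℝ) :
    T.point σ ω = T.map σ (T.digit σ ω) (T.point (T.next σ ω) (T.shift σ ω)) := by
  refine tendsto_nhds_unique ((tendsto_add_atTop_iff_nat 1).2 (T.tendsto_approx σ ω)) ?_
  obtain ⟨L, hL0, -, hl⟩ := T.lipschitz σ _ (T.digit_lt σ ω)
  rw [tendsto_iff_norm_sub_tendsto_zero]
  have h0 : Tendsto (fun n => L * ‖T.approx n (T.next σ ω) (T.shift σ ω) -
      T.point (T.next σ ω) (T.shift σ ω)‖) atTop (𝓝 0) := by
    simpa using (tendsto_iff_norm_sub_tendsto_zero.1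
      (T.tendsto_approx (T.next σ ω) (T.shift σ ω))).const_mul L
  exact squeeze_zero (fun n => norm_nonneg _)
    (fun n => hl _ (T.approx_mem n _ _) _ (T.point_mem _ _)) h0

lemma point_mem_limitSet (σ : S) (ω : ℝ) : T.point σ ω ∈ T.limitSet σ := by
  let x : ℕ → S × ℝ := fun n => (fun y => (T.next y.1 y.2, T.shift y.1 y.2))^[n] (σ, ω)
  have hx : ∀ n, x (n + 1) = (T.next (x n).1 (x n).2, T.shift (x n).1 (x n).2) :=
    fun n => Function.iterate_succ_apply' _ _ _
  refine ⟨fun n => (x n).1, fun n => T.digit (x n).1 (x n).2,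
    fun n => T.point (x n).1 (x n).2, rfl, rfl, fun n =>
      ⟨T.digit_lt _ _, ?_, T.point_mem _ _, ?_⟩⟩
  · simp only [hx]; rfl
  · simp only [hx]; exact T.point_eq _ _

/-- The mass estimate behind the lower bound for the dimension of the limit set: the set of
addresses whose points lie in a set of diameter at most `r` has measure at most `r ^ s / h σ`. -/
lemma volume_point_mem_le {s : ℝ} (m : S → ℕ → ℝ) (h : S → ℝ)
    (hh : ∀ σ, 0 < h σ) (hm : ∀ σ i, i < T.num σ → 0 < m σ i)
    (hanti : ∀ σ i, i < T.num σ → ∀ w ∈ T.disc (T.child σ i), ∀ w' ∈ T.disc (T.child σ i),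
      m σ i * ‖w - w'‖ ≤ ‖T.map σ i w - T.map σ i w'‖)
    (hmass : ∀ σ i, i < T.num σ → h σ ≤ T.num σ * m σ i ^ s * h (T.child σ i))
    (hsep : ∀ σ (F : Finset ℕ) (r : ℝ), (∀ i ∈ F, i < T.num σ) → 2 ≤ F.card →
      (∀ i ∈ F, ∀ j ∈ F, ∃ w ∈ T.disc (T.child σ i), ∃ w' ∈ T.disc (T.child σ j),
        ‖T.map σ i w - T.map σ j w'‖ ≤ r) → F.card * h σ ≤ T.num σ * r ^ s)
    (n : ℕ) (σ : S) (A : Set ℂ) (hA : MeasurableSet A) (r : ℝ) (hr : 0 ≤ r)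
    (hAr : ∀ x ∈ A, ∀ y ∈ A, ‖x - y‖ ≤ r) :
    volume {ω | ω ∈ Ico (0 : ℝ) 1 ∧ T.point σ ω ∈ A} ≤
      ENNReal.ofReal (r ^ s / h σ + (1 / 2) ^ n) := by
  classical
  -- The term `(1 / 2) ^ n` pays for stopping after `n` levels: for `n = 0` it covers the total
  -- mass, and it is at least halved at each level because a node has at least two children.
  induction n generalizing σ A r with
  | zero =>
    calc volume {ω | ω ∈ Ico (0 : ℝ) 1 ∧ T.point σ ω ∈ A} ≤ volume (Ico (0 : ℝ) 1) :=
          measure_mono fun ω hω => hω.1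
      _ = ENNReal.ofReal 1 := by simp
      _ ≤ _ := by
        apply ENNReal.ofReal_le_ofReal
        have : 0 ≤ r ^ s / h σ := div_nonneg (Real.rpow_nonneg hr s) (hh σ).le
        simpa using this
  | succ n ih =>
    set N := T.num σ with hNdef
    have hN2 : 2 ≤ N := T.two_le_num σ
    have hN : (0 : ℝ) < N := by exact_mod_cast (by omega : 0 < N)
    set F := (Finset.range N).filter
      fun i => ∃ w ∈ T.disc (T.child σ i), T.map σ i w ∈ A with hF
    have hdigit : ∀ ω ∈ Ico (0 : ℝ) 1, T.digit σ ω = ⌊(N : ℝ) * ω⌋₊ := by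
      intro ω hω
      have h1 : ⌊(N : ℝ) * ω⌋₊ < N := by
        rw [Nat.floor_lt (mul_nonneg hN.le hω.1)]
        nlinarith [hω.2]
      unfold digit
      rw [← hNdef]
      omega
    have hmemF : ∀ ω, T.point σ ω ∈ A → T.digit σ ω ∈ F := by
      intro ω hω
      rw [hF, Finset.mem_filter, Finset.mem_range]
      refine ⟨T.digit_lt σ ω, T.point (T.next σ ω) (T.shift σ ω), T.point_mem _ _, ?_⟩
      rwa [← T.point_eq]
    have hin : ∀ ω ∈ Ico (0 : ℝ) 1, (N : ℝ) * ω - T.digit σ ω ∈ Ico (0 : ℝ) 1 := by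
      intro ω hω
      rw [hdigit ω hω]
      have h1 := Nat.floor_le (mul_nonneg hN.le hω.1)
      have h2 := Nat.lt_floor_add_one ((N : ℝ) * ω)
      constructor <;> linarith
    -- If `A` can meet the images of several children, `hsep` bounds their share of the mass at
    -- once. If it can meet only one, `A` is pulled back to that child: its diameter becomes at most
    -- `r / m`, and `hmass` is exactly what turns the child's bound into the bound at `σ`.
    by_cases hc : 2 ≤ F.card
    · have hsub : {ω | ω ∈ Ico (0 : ℝ) 1 ∧ T.point σ ω ∈ A} ⊆
          ⋃ i ∈ F, Ico ((i : ℝ) / N) ((i + 1 : ℝ) / N) := by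
        rintro ω ⟨hω, hωA⟩
        refine mem_iUnion₂.2 ⟨T.digit σ ω, hmemF ω hωA, ?_⟩
        have := hin ω hω
        rw [mem_Ico, div_le_iff₀ hN, lt_div_iff₀ hN]
        constructor <;> linarith [this.1, this.2]
      calc volume {ω | ω ∈ Ico (0 : ℝ) 1 ∧ T.point σ ω ∈ A}
          ≤ volume (⋃ i ∈ F, Ico ((i : ℝ) / N) ((i + 1 : ℝ) / N)) := measure_mono hsub
        _ ≤ ∑ i ∈ F, volume (Ico ((i : ℝ) / N) ((i + 1 : ℝ) / N)) :=
            measure_biUnion_finset_le _ _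
        _ = ∑ i ∈ F, ENNReal.ofReal (1 / N) := by
            refine Finset.sum_congr rfl fun i _ => ?_
            rw [Real.volume_Ico]
            congr 1
            ring
        _ = ENNReal.ofReal (F.card / N) := by
            rw [Finset.sum_const, nsmul_eq_mul, ← ENNReal.ofReal_natCast F.card,
              ← ENNReal.ofReal_mul (by positivity)]
            congr 1
            ring
        _ ≤ _ := by
            apply ENNReal.ofReal_le_ofReal
            have h1 := hsep σ F r (fun i hi => by
              rw [hF, Finset.mem_filter, Finset.mem_range] at hi; exact hi.1) hc (by
              intro i hi j hj
              rw [hF, Finset.mem_filter] at hi hj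
              obtain ⟨-, w, hw, hwA⟩ := hi
              obtain ⟨-, w', hw', hwA'⟩ := hj
              exact ⟨w, hw, w', hw', hAr _ hwA _ hwA'⟩)
            have h2 : (F.card : ℝ) / N ≤ r ^ s / h σ := by
              rw [div_le_div_iff₀ hN (hh σ)]
              linarith
            have h3 : (0 : ℝ) ≤ (1 / 2) ^ (n + 1) := by positivity
            linarith
    · rcases F.eq_empty_or_nonempty with hFe | ⟨i, hi⟩
      · have : {ω | ω ∈ Ico (0 : ℝ) 1 ∧ T.point σ ω ∈ A} = ∅ := by
          ext ω
          simp only [mem_ofPred_eq, mem_empty_iff_false, iff_false, not_and]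
          intro _ hωA
          have := hmemF ω hωA
          simp [hFe] at this
        rw [this]
        simp
      · have hFi : ∀ j ∈ F, j = i := by
          intro j hj
          exact Finset.card_le_one.1 (by omega) j hj i hi
        have hiN : i < N := by
          rw [hF, Finset.mem_filter, Finset.mem_range] at hi; exact hi.1
        have hmi := hm σ i hiN
        set A' := T.map σ i ⁻¹' A ∩ T.disc (T.child σ i) with hA'
        have hA'm : MeasurableSet A' :=
          (T.measurable_map σ i hA).inter Metric.isClosed_closedBall.measurableSet
        have hA'r : ∀ x ∈ A', ∀ y ∈ A', ‖x - y‖ ≤ r / m σ i := by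
          intro x hx y hy
          rw [le_div_iff₀ hmi, mul_comm]
          exact (hanti σ i hiN x hx.2 y hy.2).trans (hAr _ hx.1 _ hy.1)
        have hsub : {ω | ω ∈ Ico (0 : ℝ) 1 ∧ T.point σ ω ∈ A} ⊆
            (fun ω => (N : ℝ) * ω) ⁻¹' ((fun ω => ω - (i : ℝ)) ⁻¹'
              {ω | ω ∈ Ico (0 : ℝ) 1 ∧ T.point (T.child σ i) ω ∈ A'}) := by
          rintro ω ⟨hω, hωA⟩
          have hdi := hFi _ (hmemF ω hωA)
          have h1 := hin ω hω
          have h2 : T.shift σ ω = N * ω - i := by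
            unfold shift
            rw [Int.fract_eq_iff]
            rw [hdi] at h1
            exact ⟨h1.1, h1.2, i, by rw [← hNdef]; push_cast; ring⟩
          have h3 := T.point_eq σ ω
          have h4 := T.point_mem (T.next σ ω) (T.shift σ ω)
          rw [next, hdi, h2] at h3 h4
          rw [hdi] at h1
          exact ⟨h1, by rw [mem_preimage, ← h3]; exact hωA, h4⟩
        calc volume {ω | ω ∈ Ico (0 : ℝ) 1 ∧ T.point σ ω ∈ A}
            ≤ _ := measure_mono hsub
          _ = ENNReal.ofReal (1 / N) *
              volume {ω | ω ∈ Ico (0 : ℝ) 1 ∧ T.point (T.child σ i) ω ∈ A'} := by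
              rw [Real.volume_preimage_mul_left hN.ne']
              congr 1
              · rw [abs_of_pos (inv_pos.2 hN), one_div]
              · simp_rw [sub_eq_add_neg]
                rw [measure_preimage_add_right]
          _ ≤ ENNReal.ofReal (1 / N) * ENNReal.ofReal
              ((r / m σ i) ^ s / h (T.child σ i) + (1 / 2) ^ n) := by
              gcongr
              exact ih _ _ hA'm _ (by positivity) hA'r
          _ = ENNReal.ofReal (1 / N * ((r / m σ i) ^ s / h (T.child σ i) + (1 / 2) ^ n)) := by
              rw [ENNReal.ofReal_mul (by positivity)]
          _ ≤ _ := by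
              apply ENNReal.ofReal_le_ofReal
              rw [mul_add]
              apply add_le_add
              · rw [Real.div_rpow hr hmi.le, one_div, div_div, ← div_eq_inv_mul, div_div]
                apply div_le_div_of_nonneg_left (Real.rpow_nonneg hr s) (hh σ)
                have := hmass σ i hiN
                linarith
              · have h2 : 1 / (N : ℝ) ≤ 1 / 2 := by
                  apply one_div_le_one_div_of_le (by norm_num)
                  exact_mod_cast hN2
                calc 1 / (N : ℝ) * (1 / 2) ^ n ≤ 1 / 2 * (1 / 2) ^ n := by gcongr
                  _ = (1 / 2) ^ (n + 1) := by ring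

/-- A lower bound for the Hausdorff dimension of the limit set of a tree of discs. -/
theorem le_dimH_limitSet {s : ℝ} (hs : 0 < s) (m : S → ℕ → ℝ) (h : S → ℝ)
    (hh : ∀ σ, 0 < h σ) (hm : ∀ σ i, i < T.num σ → 0 < m σ i)
    (hanti : ∀ σ i, i < T.num σ → ∀ w ∈ T.disc (T.child σ i), ∀ w' ∈ T.disc (T.child σ i),
      m σ i * ‖w - w'‖ ≤ ‖T.map σ i w - T.map σ i w'‖)
    (hmass : ∀ σ i, i < T.num σ → h σ ≤ T.num σ * m σ i ^ s * h (T.child σ i))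
    (hsep : ∀ σ (F : Finset ℕ) (r : ℝ), (∀ i ∈ F, i < T.num σ) → 2 ≤ F.card →
      (∀ i ∈ F, ∀ j ∈ F, ∃ w ∈ T.disc (T.child σ i), ∃ w' ∈ T.disc (T.child σ j),
        ‖T.map σ i w - T.map σ j w'‖ ≤ r) → F.card * h σ ≤ T.num σ * r ^ s) (σ : S) :
    ENNReal.ofReal s ≤ dimH (T.limitSet σ) := by
  set ν : Measure ℂ := (volume.restrict (Ico (0 : ℝ) 1)).map (T.point σ) with hν
  have hνA : ∀ (A : Set ℂ), MeasurableSet A → ∀ r : ℝ, 0 ≤ r →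
      (∀ x ∈ A, ∀ y ∈ A, ‖x - y‖ ≤ r) → ν A ≤ ENNReal.ofReal (r ^ s / h σ) := by
    intro A hA r hr hAr
    rw [hν, Measure.map_apply (T.measurable_point σ) hA,
      Measure.restrict_apply (T.measurable_point σ hA)]
    have h1 : T.point σ ⁻¹' A ∩ Ico 0 1 = {ω | ω ∈ Ico (0 : ℝ) 1 ∧ T.point σ ω ∈ A} := by
      ext ω
      exact and_comm
    rw [h1]
    have h2 : Tendsto (fun n : ℕ => ENNReal.ofReal (r ^ s / h σ + (1 / 2) ^ n)) atTop
        (𝓝 (ENNReal.ofReal (r ^ s / h σ + 0))) :=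
      ENNReal.tendsto_ofReal (tendsto_const_nhds.add
        (tendsto_pow_atTop_nhds_zero_of_lt_one (by norm_num) (by norm_num)))
    rw [add_zero] at h2
    exact ge_of_tendsto' h2 fun n =>
      T.volume_point_mem_le m h hh hm hanti hmass hsep n σ A hA r hr hAr
  -- Mass distribution principle. Passing to closures provides measurability and leaves diameters
  -- unchanged.
  have hle : ENNReal.ofReal (h σ) • ν ≤ Measure.hausdorffMeasure s := by
    refine Measure.le_hausdorffMeasure s _ 1 one_pos fun A hA => ?_
    have hcl : Metric.ediam (closure A) ≤ 1 := by rwa [Metric.ediam_closure]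
    have hb : Bornology.IsBounded (closure A) :=
      Metric.isBounded_iff_ediam_ne_top.2 (ne_top_of_le_ne_top ENNReal.one_ne_top hcl)
    have h1 := hνA (closure A) isClosed_closure.measurableSet (Metric.diam (closure A))
      Metric.diam_nonneg (fun x hx y hy => by
        rw [← dist_eq_norm]; exact Metric.dist_le_diam_of_mem hb hx hy)
    rw [Measure.smul_apply, smul_eq_mul]
    calc ENNReal.ofReal (h σ) * ν A ≤ ENNReal.ofReal (h σ) * ν (closure A) := by
          gcongr; exact subset_closure
      _ ≤ ENNReal.ofReal (h σ) * ENNReal.ofReal (Metric.diam (closure A) ^ s / h σ) := by gcongr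
      _ = ENNReal.ofReal (Metric.diam (closure A) ^ s) := by
          rw [← ENNReal.ofReal_mul (hh σ).le, mul_div_cancel₀ _ (hh σ).ne']
      _ = Metric.ediam A ^ s := by
          rw [← ENNReal.ofReal_rpow_of_nonneg Metric.diam_nonneg hs.le, Metric.diam,
            ENNReal.ofReal_toReal hb.ediam_ne_top, Metric.ediam_closure]
  have hpos : 0 < ENNReal.ofReal (h σ) * ν (T.limitSet σ) := by
    refine ENNReal.mul_pos (by simpa using hh σ) ?_
    -- The limit set is not known to be measurable, so only the inequality valid for arbitrary sets
    -- is used.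
    have h1 : (volume.restrict (Ico (0 : ℝ) 1)) (T.point σ ⁻¹' T.limitSet σ) ≤
        ν (T.limitSet σ) := Measure.le_map_apply (T.measurable_point σ).aemeasurable _
    have h2 : T.point σ ⁻¹' T.limitSet σ = univ :=
      eq_univ_of_forall fun ω => T.point_mem_limitSet σ ω
    rw [h2] at h1
    simp at h1
    intro h0
    rw [h0] at h1
    simp at h1
  have hne : Measure.hausdorffMeasure s (T.limitSet σ) ≠ 0 :=
    (hpos.trans_le (hle _)).ne'
  have := le_dimH_of_hausdorffMeasure_ne_zero (d := s.toNNReal) (s := T.limitSet σ)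
    (by rwa [Real.coe_toNNReal s hs.le])
  exact this

end DiscTree

/-! ### Holomorphy of inverses; crude Bloch and Koebe theorems. -/

/-- If `f ∘ ψ` is differentiable at `w` and `f` is holomorphic with nonzero derivative at `ψ w`,
then a continuous `ψ` is differentiable at `w`. -/
lemma differentiableAt_of_comp_eventuallyEq {f ψ h : ℂ → ℂ} {w : ℂ} (hf : AnalyticAt ℂ f (ψ w))
    (hf' : deriv f (ψ w) ≠ 0) (hψ : ContinuousAt ψ w) (hfψ : f ∘ ψ =ᶠ[𝓝 w] h)
    (hh : DifferentiableAt ℂ h w) : DifferentiableAt ℂ ψ w := by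
  have hs : HasStrictDerivAt f (deriv f (ψ w)) (ψ w) := hf.hasStrictDerivAt
  have hk : HasDerivAt (hs.localInverse f _ _ hf') (deriv f (ψ w))⁻¹ (f (ψ w)) :=
    (hs.to_localInverse hf').hasDerivAt
  have hl : ∀ᶠ x in 𝓝 (ψ w), hs.localInverse f _ _ hf' (f x) = x :=
    hs.hasStrictFDerivAt_equiv hf' |>.eventually_left_inverse
  have he : ψ =ᶠ[𝓝 w] hs.localInverse f _ _ hf' ∘ h := by
    filter_upwards [hψ.eventually hl, hfψ] with x hx hx'
    rw [Function.comp_apply, ← hx', Function.comp_apply, hx]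
  have hw : h w = f (ψ w) := hfψ.self_of_nhds.symm
  refine DifferentiableAt.congr_of_eventuallyEq ?_ he
  refine DifferentiableAt.comp w ?_ hh
  rw [hw]
  exact hk.differentiableAt

/-- An injective continuous map whose composition with a holomorphic map is holomorphic with
nonvanishing derivative is itself holomorphic. -/
lemma differentiableOn_of_comp_eqOn {f ψ h : ℂ → ℂ} {U V : Set ℂ} (hU : IsOpen U) (hV : IsOpen V)
    (hψ : ContinuousOn ψ U) (hinj : InjOn ψ U) (hmaps : MapsTo ψ U V)
    (hf : DifferentiableOn ℂ f V) (hfψ : EqOn (f ∘ ψ) h U) (hh : DifferentiableOn ℂ h U)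
    (hh' : ∀ w ∈ U, deriv h w ≠ 0) : DifferentiableOn ℂ ψ U := by
  have hgood : ∀ w ∈ U, deriv f (ψ w) ≠ 0 → DifferentiableAt ℂ ψ w := fun w hw hw' =>
    differentiableAt_of_comp_eventuallyEq (hf.analyticAt (hV.mem_nhds (hmaps hw))) hw'
      (hψ.continuousAt (hU.mem_nhds hw)) (hfψ.eventuallyEq_of_mem (hU.mem_nhds hw))
      (hh.differentiableAt (hU.mem_nhds hw))
  intro w hw
  have hUw := hU.mem_nhds hw
  have hc := hψ.continuousAt hUw
  have hfa : AnalyticAt ℂ f (ψ w) := hf.analyticAt (hV.mem_nhds (hmaps hw))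
  -- Only zeros of `f'` are in doubt. They are isolated, since otherwise `f` and hence `h` would be
  -- locally constant; so `ψ` has a removable singularity at `w`.
  refine (Complex.analyticAt_of_differentiable_on_punctured_nhds_of_continuousAt ?_
    hc).differentiableAt.differentiableWithinAt
  rcases hfa.deriv.eventually_eq_zero_or_eventually_ne_zero with h0 | h0
  · exfalso
    obtain ⟨ε, hε, hball⟩ := Metric.eventually_nhds_iff_ball.1
      (h0.and (hV.eventually_mem (hmaps hw)))
    have hconst : ∀ z ∈ Metric.ball (ψ w) ε, f z = f (ψ w) := fun z hz =>
      Metric.isOpen_ball.is_const_of_deriv_eq_zero (convex_ball _ _).isPreconnected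
        (hf.mono fun x hx => (hball x hx).2) (fun x hx => (hball x hx).1) hz
        (Metric.mem_ball_self hε)
    refine hh' w hw ?_
    have : h =ᶠ[𝓝 w] fun _ => f (ψ w) := by
      filter_upwards [hc.eventually (Metric.ball_mem_nhds _ hε), hUw] with x hx hxU
      rw [← hfψ hxU, Function.comp_apply, hconst _ hx]
    rw [this.deriv_eq, deriv_const]
  · have h1 : Tendsto ψ (𝓝[≠] w) (𝓝[≠] (ψ w)) := by
      refine tendsto_nhdsWithin_iff.2 ⟨hc.tendsto.mono_left nhdsWithin_le_nhds, ?_⟩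
      filter_upwards [self_mem_nhdsWithin, mem_nhdsWithin_of_mem_nhds hUw] with x hx hxU
      exact fun h => hx (hinj hxU hw h)
    filter_upwards [h1.eventually h0, mem_nhdsWithin_of_mem_nhds hUw] with x hx hxU
    exact hgood x hxU hx

/-- A nonvanishing holomorphic function on a convex open set has a holomorphic logarithm. -/
lemma exists_differentiableOn_log {G : ℂ → ℂ} {U : Set ℂ} (hU : IsOpen U) (hc : Convex ℝ U)
    (hne : U.Nonempty) (hG : DifferentiableOn ℂ G U) (h0 : ∀ w ∈ U, G w ≠ 0) :
    ∃ g : ℂ → ℂ, DifferentiableOn ℂ g U ∧ ∀ w ∈ U, Complex.exp (g w) = G w := by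
  have : ContractibleSpace U := hc.contractibleSpace hne
  have hsc : IsSimplyConnected U := (inferInstance : SimplyConnectedSpace U)
  obtain ⟨g, hgc, hg⟩ := Complex.exists_continuousOn_eqOn_exp_comp hsc hU hG.continuousOn
    (by rintro ⟨w, hw, hw0⟩; exact h0 w hw hw0)
  refine ⟨g, fun w hw => ?_, hg⟩
  exact (differentiableAt_of_comp_eventuallyEq (f := Complex.exp) (h := G)
    analyticAt_cexp (by simp [Complex.exp_ne_zero])
    (hgc.continuousAt (hU.mem_nhds hw)) (hg.eventuallyEq_of_mem (hU.mem_nhds hw))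
    (hG.differentiableAt (hU.mem_nhds hw))).differentiableWithinAt

/-- A holomorphic function whose derivative is `ε`-close to its value at the centre of a disc is
nearly affine there. -/
lemma norm_sub_sub_mul_le_of_norm_deriv_sub_le {f : ℂ → ℂ} {U : Set ℂ} {c : ℂ} {ε : ℝ}
    (hU : Convex ℝ U) (hf : ∀ x ∈ U, DifferentiableAt ℂ f x)
    (hd : ∀ x ∈ U, ‖deriv f x - c‖ ≤ ε) {z w : ℂ} (hz : z ∈ U) (hw : w ∈ U) :
    ‖f z - f w - c * (z - w)‖ ≤ ε * ‖z - w‖ := by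
  have := hU.norm_image_sub_le_of_norm_deriv_le (𝕜 := ℂ) (f := fun x => f x - c * x) (C := ε)
    (fun x hx => (hf x hx).sub (by fun_prop)) (fun x hx => by
      have h1 : HasDerivAt (fun x => f x - c * x) (deriv f x - c * 1) x :=
        (hf x hx).hasDerivAt.sub ((hasDerivAt_id x).const_mul c)
      rw [h1.deriv, mul_one]
      exact hd x hx) hw hz
  rwa [show f z - f w - c * (z - w) = f z - c * z - (f w - c * w) by ring]

/-- Bloch's theorem with a crude constant. -/
lemma exists_ball_subset_image_ball {f : ℂ → ℂ} {a : ℂ} {r : ℝ} (hr : 0 < r)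
    (hf : DifferentiableOn ℂ f (Metric.ball a r)) :
    ∃ w, Metric.ball w (r * ‖deriv f a‖ / 96) ⊆ f '' Metric.ball a r := by
  by_cases hfa : deriv f a = 0
  · exact ⟨0, by simp [hfa]⟩
  have hfa' : 0 < ‖deriv f a‖ := norm_pos_iff.2 hfa
  have hf' : DifferentiableOn ℂ (deriv f) (Metric.ball a r) := hf.deriv Metric.isOpen_ball
  set t := r / 2 with ht
  have ht0 : 0 < t := by positivity
  have hsub : Metric.closedBall a t ⊆ Metric.ball a r := Metric.closedBall_subset_ball (by linarith)
  -- Maximising `|f'(z)| (t - |z - a|)` moves the centre to a point `b` near which `|f'|` is at most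
  -- twice `|f'(b)|`.
  obtain ⟨b, hb, hmax⟩ := (isCompact_closedBall a t).exists_isMaxOn
    ⟨a, Metric.mem_closedBall_self ht0.le⟩
    (f := fun z => ‖deriv f z‖ * (t - ‖z - a‖))
    ((hf'.continuousOn.mono hsub).norm.mul (by fun_prop))
  rw [isMaxOn_iff] at hmax
  have hba := hmax a (Metric.mem_closedBall_self ht0.le)
  simp only [sub_self, norm_zero, sub_zero] at hba
  have hpos : 0 < ‖deriv f b‖ * (t - ‖b - a‖) := lt_of_lt_of_le (by positivity) hba
  have hA : 0 < ‖deriv f b‖ := by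
    rcases (norm_nonneg (deriv f b)).eq_or_lt with h | h
    · rw [← h] at hpos; simp at hpos
    · exact h
  have hτ' : 0 < t - ‖b - a‖ := by
    by_contra h
    push Not at h
    nlinarith
  set A := ‖deriv f b‖
  set τ := (t - ‖b - a‖) / 2 with hτ
  have hτ0 : 0 < τ := by positivity
  have hballb : ∀ z ∈ Metric.ball b τ, ‖z - a‖ ≤ t - τ := by
    intro z hz
    rw [mem_ball_iff_norm] at hz
    have : ‖z - a‖ ≤ ‖z - b‖ + ‖b - a‖ := by
      calc ‖z - a‖ = ‖(z - b) + (b - a)‖ := by ring_nf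
        _ ≤ _ := norm_add_le _ _
    linarith
  have hsubb : Metric.ball b τ ⊆ Metric.ball a r := fun z hz => by
    rw [mem_ball_iff_norm]
    have := hballb z hz
    linarith
  have hder : ∀ z ∈ Metric.ball b τ, ‖deriv f z‖ ≤ 2 * A := by
    intro z hz
    have h1 := hballb z hz
    have h2 := hmax z (by rw [mem_closedBall_iff_norm]; linarith)
    have h3 : ‖deriv f z‖ * τ ≤ A * (2 * τ) := by
      calc ‖deriv f z‖ * τ ≤ ‖deriv f z‖ * (t - ‖z - a‖) := by gcongr; linarith
        _ ≤ A * (t - ‖b - a‖) := h2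
        _ = A * (2 * τ) := by rw [hτ]; ring
    nlinarith
  -- Schwarz lemma for `f' - f'(b)`, which is bounded by `3A` on the disc of radius `τ`.
  have hschwarz : ∀ z ∈ Metric.closedBall b (τ / 6), ‖deriv f z - deriv f b‖ ≤ A / 2 := by
    intro z hz
    have hzb : z ∈ Metric.ball b τ := Metric.closedBall_subset_ball (by linarith) hz
    have h1 := Complex.dist_le_div_mul_dist_of_mapsTo_ball (hf'.mono hsubb) (R₂ := 3 * A) (by
      intro x hx
      rw [mem_closedBall_iff_norm]
      calc ‖deriv f x - deriv f b‖ ≤ ‖deriv f x‖ + ‖deriv f b‖ := norm_sub_le _ _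
        _ ≤ 2 * A + A := by gcongr; exact hder x hx
        _ = 3 * A := by ring) hzb
    rw [dist_eq_norm] at h1
    rw [Metric.mem_closedBall] at hz
    calc ‖deriv f z - deriv f b‖ ≤ 3 * A / τ * dist z b := h1
      _ ≤ 3 * A / τ * (τ / 6) := by gcongr
      _ = A / 2 := by field_simp; norm_num
  have hcsub : Metric.closedBall b (τ / 6) ⊆ Metric.ball a r :=
    (Metric.closedBall_subset_ball (by linarith)).trans hsubb
  refine ⟨f b, ?_⟩
  have hdiff : ∀ x ∈ Metric.closedBall b (τ / 6), DifferentiableAt ℂ f x := fun x hx =>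
    hf.differentiableAt (Metric.isOpen_ball.mem_nhds (hcsub hx))
  have hb6 : b ∈ Metric.closedBall b (τ / 6) := Metric.mem_closedBall_self (by positivity)
  -- On the circle of radius `τ / 6`, `f` stays `Aτ / 12` away from `f b`, so the image contains a
  -- disc of radius `Aτ / 24`; maximality gives `Aτ ≥ r |f'(a)| / 4`, whence the 96.
  have hbig := DiffContOnCl.ball_subset_image_closedBall (f := f) (z₀ := b) (r := τ / 6)
    (ε := A * τ / 12) ((hf.mono (by
      rw [closure_ball b (by positivity : τ / 6 ≠ 0)]; exact hcsub)).diffContOnCl)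
    (by positivity) (fun z hz => by
      have hz' := Metric.sphere_subset_closedBall hz
      have h1 := norm_sub_sub_mul_le_of_norm_deriv_sub_le (convex_closedBall b (τ / 6)) hdiff
        hschwarz hz' hb6
      have h2 : ‖z - b‖ = τ / 6 := by rwa [mem_sphere_iff_norm] at hz
      have h3 : ‖deriv f b * (z - b)‖ ≤ ‖f z - f b‖ + ‖f z - f b - deriv f b * (z - b)‖ := by
        calc ‖deriv f b * (z - b)‖ =
              ‖(f z - f b) - (f z - f b - deriv f b * (z - b))‖ := by ring_nf
          _ ≤ _ := norm_sub_le _ _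
      rw [norm_mul, h2] at h3
      rw [h2] at h1
      change A * (τ / 6) ≤ _ at h3
      linarith) (by
      have h1 : ∀ᶠ z in 𝓝[≠] b, f z ≠ f b :=
        (hdiff b hb6).hasDerivAt.eventually_ne (norm_pos_iff.1 hA)
      exact h1.frequently.filter_mono nhdsWithin_le_nhds)
  refine (Metric.ball_subset_ball ?_).trans (hbig.trans (image_mono hcsub))
  have : A * (t - ‖b - a‖) = A * (2 * τ) := by rw [hτ]; ring
  nlinarith

/-- The derivative of the logarithm of an injective zero-free function on a disc. -/
lemma norm_deriv_mul_le_of_exp_injOn {g : ℂ → ℂ} {a : ℂ} {r : ℝ} (hr : 0 < r)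
    (hg : DifferentiableOn ℂ g (Metric.ball a r))
    (hinj : InjOn (fun w => Complex.exp (g w)) (Metric.ball a r)) :
    ‖deriv g a‖ * r ≤ 672 := by
  by_contra! h
  obtain ⟨w, hw⟩ := exists_ball_subset_image_ball hr hg
  -- A disc of radius greater than `2π` contains two points differing by `2πi`, which `exp`
  -- identifies; `672 = 96 * 7`.
  have hR : 7 < r * ‖deriv g a‖ / 96 := by linarith
  obtain ⟨z₁, hz₁, h1⟩ := hw (Metric.mem_ball_self (by linarith))
  obtain ⟨z₂, hz₂, h2⟩ := hw (show w + 2 * Real.pi * Complex.I ∈ Metric.ball w _ by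
    rw [mem_ball_iff_norm, add_sub_cancel_left]
    simp only [norm_mul, Complex.norm_I, mul_one, Complex.norm_ofNat, Complex.norm_real,
      Real.norm_eq_abs, abs_of_pos Real.pi_pos]
    linarith [Real.pi_lt_d2])
  have h3 := hinj hz₁ hz₂ (by simp only [h1, h2, Complex.exp_periodic w])
  rw [h3, h2] at h1
  simp [Real.pi_ne_zero] at h1

/-- Koebe's one quarter theorem with a crude constant. -/
lemma norm_deriv_mul_le_of_notMem_image {f : ℂ → ℂ} {a v : ℂ} {r : ℝ} (hr : 0 < r)
    (hf : DifferentiableOn ℂ f (Metric.ball a r)) (hinj : InjOn f (Metric.ball a r))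
    (hv : v ∉ f '' Metric.ball a r) : ‖deriv f a‖ * r ≤ 672 * ‖f a - v‖ := by
  have hne : ∀ w ∈ Metric.ball a r, f w - v ≠ 0 := fun w hw h =>
    hv ⟨w, hw, sub_eq_zero.1 h⟩
  -- The logarithm of `f - v` falls under the previous bound, as its exponential is injective.
  obtain ⟨g, hg, hgf⟩ := exists_differentiableOn_log Metric.isOpen_ball (convex_ball a r)
    ⟨a, Metric.mem_ball_self hr⟩ (hf.sub_const v) hne
  have h1 := norm_deriv_mul_le_of_exp_injOn hr hg (fun x hx y hy hxy => by
    simp only [hgf x hx, hgf y hy, sub_left_inj] at hxy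
    exact hinj hx hy hxy)
  have ha := Metric.mem_ball_self (x := a) hr
  have hnh := Metric.isOpen_ball.mem_nhds ha
  have h2 : deriv f a = (f a - v) * deriv g a := by
    have h3 : HasDerivAt (fun w => Complex.exp (g w)) (Complex.exp (g a) * deriv g a) a :=
      (hg.differentiableAt hnh).hasDerivAt.cexp
    have h4 : HasDerivAt (fun w => f w - v) (deriv f a) a :=
      (hf.differentiableAt hnh).hasDerivAt.sub_const v
    rw [← hgf a ha]
    exact h4.unique (h3.congr_of_eventuallyEq
      (Filter.eventuallyEq_of_mem hnh fun w hw => (hgf w hw).symm))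
  rw [h2, norm_mul, mul_assoc, mul_comm (672 : ℝ)]
  gcongr

/-- Koebe's distortion theorem with a crude constant. -/
lemma norm_deriv_sub_le_of_injOn {f : ℂ → ℂ} {a : ℂ} {r : ℝ} (hr : 0 < r)
    (hf : DifferentiableOn ℂ f (Metric.ball a r)) (hinj : InjOn f (Metric.ball a r))
    (hfa : deriv f a ≠ 0) {z : ℂ} (hz : z ∈ Metric.ball a (r / (320 * 672 ^ 2))) :
    ‖deriv f z - deriv f a‖ ≤ ‖deriv f a‖ / 2 := by
  set B := Metric.ball a r with hB
  have haB : a ∈ B := Metric.mem_ball_self hr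
  set d := ‖deriv f a‖ with hd
  have hd0 : 0 < d := norm_pos_iff.2 hfa
  set s := r * d / 672 with hs
  have hs0 : 0 < s := by positivity
  have hsub : Metric.ball (f a) s ⊆ f '' B := by
    intro v hv
    by_contra h
    have := norm_deriv_mul_le_of_notMem_image hr hf hinj h
    rw [mem_ball_iff_norm'] at hv
    rw [hs, lt_div_iff₀ (by norm_num)] at hv
    linarith
  have hopen : ∀ u ⊆ B, IsOpen u → IsOpen (f '' u) := by
    rcases (hf.analyticOnNhd Metric.isOpen_ball).is_constant_or_isOpen
      (convex_ball a r).isPreconnected with ⟨w, hw⟩ | h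
    · exfalso
      refine hfa ?_
      have : f =ᶠ[𝓝 a] fun _ => w := eventuallyEq_of_mem (Metric.ball_mem_nhds a hr) hw
      rw [this.deriv_eq, deriv_const]
    · exact h
  -- Distortion is first estimated for the inverse `φ`: it is defined on a disc of radius `s` and
  -- takes values in a disc of radius `r`, so Cauchy and Schwarz apply to it.
  set φ := Function.invFunOn f B with hφ
  have hφB : ∀ w ∈ f '' B, φ w ∈ B := fun w hw => Function.invFunOn_mem hw
  have hfφ : ∀ w ∈ f '' B, f (φ w) = w := fun w hw => Function.invFunOn_eq hw
  have hφf : ∀ x ∈ B, φ (f x) = x := fun x hx =>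
    hinj (hφB _ (mem_image_of_mem f hx)) hx (hfφ _ (mem_image_of_mem f hx))
  have himg : IsOpen (f '' B) := hopen B Subset.rfl Metric.isOpen_ball
  have hφc : ContinuousOn φ (f '' B) := by
    rw [continuousOn_open_iff himg]
    intro u hu
    have : f '' B ∩ φ ⁻¹' u = f '' (B ∩ u) := by
      ext w
      constructor
      · rintro ⟨hw, hwu⟩
        exact ⟨φ w, ⟨hφB w hw, hwu⟩, hfφ w hw⟩
      · rintro ⟨x, ⟨hxB, hxu⟩, rfl⟩
        exact ⟨mem_image_of_mem f hxB, by rwa [mem_preimage, hφf x hxB]⟩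
    rw [this]
    exact hopen _ inter_subset_left (Metric.isOpen_ball.inter hu)
  have hφd : DifferentiableOn ℂ φ (f '' B) :=
    differentiableOn_of_comp_eqOn (f := f) (h := id) himg Metric.isOpen_ball hφc
      (fun x hx y hy hxy => by rw [← hfφ x hx, hxy, hfφ y hy]) hφB hf hfφ differentiableOn_id
      (by simp)
  have hchain : ∀ w ∈ f '' B, deriv f (φ w) * deriv φ w = 1 := by
    intro w hw
    have h1 : HasDerivAt (f ∘ φ) (deriv f (φ w) * deriv φ w) w :=
      HasDerivAt.comp w (hf.differentiableAt (Metric.isOpen_ball.mem_nhds (hφB w hw))).hasDerivAt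
        (hφd.differentiableAt (himg.mem_nhds hw)).hasDerivAt
    exact h1.unique ((hasDerivAt_id w).congr_of_eventuallyEq
      (eventuallyEq_of_mem (himg.mem_nhds hw) hfφ))
  have hfaI : f a ∈ f '' B := mem_image_of_mem f haB
  have hbound : ∀ w ∈ Metric.ball (f a) (s / 2), ‖deriv φ w‖ ≤ 4 * r / s := by
    intro w hw
    have hsw : Metric.ball w (s / 2) ⊆ Metric.ball (f a) s :=
      Metric.ball_subset_ball' (by rw [Metric.mem_ball] at hw; linarith)
    have h1 := Complex.norm_deriv_le_div_of_mapsTo_ball (R₂ := 2 * r)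
      (hφd.mono (hsw.trans hsub)) (fun x hx => by
        have h1 := hφB x (hsub (hsw hx))
        have h2 := hφB w (hsub (hsw (Metric.mem_ball_self (by positivity))))
        rw [hB, mem_ball_iff_norm] at h1 h2
        rw [mem_closedBall_iff_norm]
        calc ‖φ x - φ w‖ = ‖(φ x - a) - (φ w - a)‖ := by ring_nf
          _ ≤ ‖φ x - a‖ + ‖φ w - a‖ := norm_sub_le _ _
          _ ≤ 2 * r := by linarith) (by positivity)
    calc ‖deriv φ w‖ ≤ 2 * r / (s / 2) := h1
      _ = 4 * r / s := by field_simp; norm_num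
  -- Chosen so that `φ'` varies by at most a fifth of `|φ'(f a)| = 1 / d`.
  set ρ := s / (80 * 672) with hρ
  have hρ0 : 0 < ρ := by positivity
  have hρs : ρ < s / 2 := by rw [hρ, div_lt_div_iff₀ (by norm_num) (by norm_num)]; linarith
  have hclose : ∀ w ∈ Metric.closedBall (f a) ρ, ‖deriv φ w - deriv φ (f a)‖ ≤ 1 / (5 * d) := by
    intro w hw
    have h1 := Complex.dist_le_div_mul_dist_of_mapsTo_ball (R₂ := 8 * r / s)
      ((hφd.deriv himg).mono ((Metric.ball_subset_ball (by linarith)).trans hsub))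
      (fun x hx => by
        have h1 := hbound x hx
        have h2 := hbound (f a) (Metric.mem_ball_self (by positivity))
        rw [mem_closedBall_iff_norm]
        calc ‖deriv φ x - deriv φ (f a)‖ ≤ ‖deriv φ x‖ + ‖deriv φ (f a)‖ := norm_sub_le _ _
          _ ≤ 4 * r / s + 4 * r / s := add_le_add h1 h2
          _ = 8 * r / s := by ring) (Metric.closedBall_subset_ball hρs hw)
    rw [dist_eq_norm] at h1
    rw [Metric.mem_closedBall] at hw
    calc ‖deriv φ w - deriv φ (f a)‖ ≤ 8 * r / s / (s / 2) * dist w (f a) := h1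
      _ ≤ 8 * r / s / (s / 2) * ρ := by gcongr
      _ = 1 / (5 * d) := by rw [hρ, hs]; field_simp; norm_num
  have hφa : φ (f a) = a := hφf a haB
  have hda := hchain _ hfaI
  rw [hφa] at hda
  have hda' : d * ‖deriv φ (f a)‖ = 1 := by rw [hd, ← norm_mul, hda, norm_one]
  have hcsub : Metric.closedBall (f a) ρ ⊆ f '' B :=
    (Metric.closedBall_subset_ball (by linarith)).trans hsub
  have hfa0 : f a ∈ Metric.closedBall (f a) ρ := Metric.mem_closedBall_self hρ0.le
  have hdiff : ∀ x ∈ Metric.closedBall (f a) ρ, DifferentiableAt ℂ φ x := fun x hx =>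
    hφd.differentiableAt (himg.mem_nhds (hcsub hx))
  have hcover := DiffContOnCl.ball_subset_image_closedBall (f := φ) (z₀ := f a) (r := ρ)
    (ε := ρ / (2 * d)) ((hφd.mono (by
      rw [closure_ball _ hρ0.ne']; exact hcsub)).diffContOnCl) hρ0 (fun w hw => by
      have hw' := Metric.sphere_subset_closedBall hw
      have h1 := norm_sub_sub_mul_le_of_norm_deriv_sub_le (convex_closedBall _ _) hdiff
        hclose hw' hfa0
      have h2 : ‖w - f a‖ = ρ := by rwa [mem_sphere_iff_norm] at hw
      have h3 : ‖deriv φ (f a) * (w - f a)‖ ≤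
          ‖φ w - φ (f a)‖ + ‖φ w - φ (f a) - deriv φ (f a) * (w - f a)‖ := by
        calc ‖deriv φ (f a) * (w - f a)‖ =
              ‖(φ w - φ (f a)) - (φ w - φ (f a) - deriv φ (f a) * (w - f a))‖ := by ring_nf
          _ ≤ _ := norm_sub_le _ _
      have h4 : ‖deriv φ (f a)‖ = 1 / d := by field_simp; linarith
      rw [norm_mul, h2, h4] at h3
      rw [h2] at h1
      have h5 : 1 / d * ρ - 1 / (5 * d) * ρ = 4 / 5 * (ρ / d) := by field_simp; norm_num
      have h6 : ρ / (2 * d) = 1 / 2 * (ρ / d) := by field_simp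
      have h7 : 0 < ρ / d := by positivity
      linarith) (by
      have h1 : ∀ᶠ z in 𝓝[≠] (f a), φ z ≠ φ (f a) :=
        (hdiff _ hfa0).hasDerivAt.eventually_ne (right_ne_zero_of_mul (by rw [hda]; simp))
      exact h1.frequently.filter_mono nhdsWithin_le_nhds)
  rw [hφa] at hcover
  have hrad : r / (320 * 672 ^ 2) ≤ ρ / (2 * d) / 2 := by
    rw [hρ, hs]
    apply le_of_eq
    field_simp
    norm_num
  obtain ⟨w, hw, rfl⟩ := hcover (Metric.ball_subset_ball hrad hz)
  have h1 := hclose w hw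
  have h2 := hchain w (hcsub hw)
  have h3 : ‖deriv f (φ w)‖ * ‖deriv φ w‖ = 1 := by rw [← norm_mul, h2, norm_one]
  have h4 : 1 / d ≤ ‖deriv φ w‖ + 1 / (5 * d) := by
    have h5 : ‖deriv φ (f a)‖ ≤ ‖deriv φ w‖ + ‖deriv φ w - deriv φ (f a)‖ := by
      calc ‖deriv φ (f a)‖ = ‖deriv φ w - (deriv φ w - deriv φ (f a))‖ := by ring_nf
        _ ≤ _ := norm_sub_le _ _
    have h4 : ‖deriv φ (f a)‖ = 1 / d := by field_simp; linarith
    linarith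
  have h5 : 4 / 5 ≤ d * ‖deriv φ w‖ := by
    have : 1 / d = 5 * (1 / (5 * d)) := by field_simp
    have h6 : d * (1 / d) ≤ d * (‖deriv φ w‖ + 1 / (5 * d)) := by gcongr
    have h7 : d * (1 / d) = 1 := by field_simp
    have h8 : d * (1 / (5 * d)) = 1 / 5 := by field_simp
    rw [mul_add, h7, h8] at h6
    linarith
  -- The chain rule transfers closeness of `φ'` to closeness of `f'`.
  have h6 : deriv f (φ w) - deriv f a =
      deriv f (φ w) * deriv f a * (deriv φ (f a) - deriv φ w) := by
    calc deriv f (φ w) - deriv f a = deriv f (φ w) * (deriv f a * deriv φ (f a)) -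
        deriv f a * (deriv f (φ w) * deriv φ w) := by rw [hda, h2]; ring
      _ = _ := by ring
  rw [h6, norm_mul, norm_mul, norm_sub_rev, ← hd]
  set e := ‖deriv f (φ w)‖
  have he0 : 0 ≤ e := norm_nonneg _
  have h7 : e * (4 / 5) ≤ d := by
    calc e * (4 / 5) ≤ e * (d * ‖deriv φ w‖) := by gcongr
      _ = d * (e * ‖deriv φ w‖) := by ring
      _ = d := by rw [h3, mul_one]
  calc e * d * ‖deriv φ w - deriv φ (f a)‖ ≤ e * d * (1 / (5 * d)) := by gcongr
    _ = e / 5 := by field_simp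
    _ ≤ d / 2 := by linarith

/-! ### Logarithmic coordinates in the tract. -/

lemma convex_re_gt (a : ℝ) : Convex ℝ {w : ℂ | a < w.re} :=
  convex_halfSpace_re_gt a

lemma isOpen_re_gt (a : ℝ) : IsOpen {w : ℂ | a < w.re} :=
  isOpen_lt continuous_const Complex.continuous_re

/-- A right inverse of a continuous logarithm is injective. -/
lemma injOn_of_exp_comp_eq {G L : ℂ → ℂ} {U V : Set ℂ} (hU : IsOpen U) (hc : Convex ℝ U)
    (hG : ContinuousOn G U) (hGV : MapsTo G U V) (hL : ContinuousOn L V)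
    (h : ∀ w ∈ U, Complex.exp (L (G w)) = Complex.exp w) : InjOn G U := by
  -- The difference `L (G w) - w` takes values in `2πiℤ`, hence is constant on `U`; thus `L ∘ G` is
  -- a translation.
  have hδc : ContinuousOn (fun w => L (G w) - w) U := (hL.comp hG hGV).sub continuousOn_id
  have hδ : ∀ w ∈ U, Complex.exp (L (G w) - w) = 1 := fun w hw => by
    rw [Complex.exp_sub, h w hw, div_self (Complex.exp_ne_zero w)]
  have hδd : ∀ w ∈ U, DifferentiableAt ℂ (fun w => L (G w) - w) w := fun w hw =>
    differentiableAt_of_comp_eventuallyEq (f := Complex.exp) (h := fun _ => 1)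
      analyticAt_cexp (by simp [Complex.exp_ne_zero]) (hδc.continuousAt (hU.mem_nhds hw))
      (eventuallyEq_of_mem (hU.mem_nhds hw) hδ) (differentiableAt_const _)
  have hconst : ∀ w ∈ U, ∀ w' ∈ U, L (G w) - w = L (G w') - w' := by
    intro w hw w' hw'
    refine hU.is_const_of_deriv_eq_zero hc.isPreconnected
      (fun x hx => (hδd x hx).differentiableWithinAt) (fun x hx => ?_) hw hw'
    have h1 := (hδd x hx).hasDerivAt.cexp
    have h2 := h1.unique ((hasDerivAt_const x (1 : ℂ)).congr_of_eventuallyEq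
      (eventuallyEq_of_mem (hU.mem_nhds hx) hδ))
    simpa [Complex.exp_ne_zero] using h2
  intro w hw w' hw' hww'
  have := hconst w hw w' hw'
  rw [hww'] at this
  linear_combination -this

/-- The exponential function lifts to a conformal map from a half-plane into a logarithmic
tract. -/
lemma IsLogarithmicTract.exists_inverse_branch {f : ℂ → ℂ} {D : Set ℂ}
    (hD : IsLogarithmicTract f D) :
    ∃ (a : ℝ) (G : ℂ → ℂ), DifferentiableOn ℂ G {w | a < w.re} ∧ InjOn G {w | a < w.re} ∧
      ∀ w : ℂ, a < w.re → G w ∈ D ∧ f (G w) = Complex.exp w := by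
  obtain ⟨R, hR, hsc, himg, hmaps, hcov⟩ := hD.covering
  set a := Real.log R
  set U : Set ℂ := {w | a < w.re} with hUdef
  have hUo : IsOpen U := isOpen_re_gt a
  have hUc : Convex ℝ U := convex_re_gt a
  have hexp : ∀ w ∈ U, Complex.exp w ∈ {w : ℂ | R < ‖w‖} := by
    intro w hw
    change R < ‖Complex.exp w‖
    rw [Complex.norm_exp]
    exact (Real.log_lt_iff_lt_exp hR).1 hw
  have hw₀ : ((a + 1 : ℝ) : ℂ) ∈ U := by simp [hUdef]
  have : ContractibleSpace U := hUc.contractibleSpace ⟨_, hw₀⟩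
  have : LocallyPathConnectedSpace U := hUo.locallyPathConnectedSpace
  obtain ⟨z₀, hz₀D, hz₀⟩ : Complex.exp ((a + 1 : ℝ) : ℂ) ∈ f '' D := by
    rw [himg]; exact hexp _ hw₀
  let F : C(U, {w : ℂ | R < ‖w‖}) :=
    ⟨fun w => ⟨Complex.exp w, hexp w w.2⟩, by fun_prop⟩
  obtain ⟨Γ, ⟨-, hΓ⟩, -⟩ := hcov.existsUnique_continuousMap_lifts F ⟨_, hw₀⟩ ⟨z₀, hz₀D⟩
    (Subtype.ext hz₀)
  obtain ⟨G, hG⟩ : ∃ G : ℂ → ℂ, ∀ w : U, G w = Γ w := by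
    classical
    exact ⟨fun w => if hw : w ∈ U then (Γ ⟨w, hw⟩ : ℂ) else 0, fun w => by simp⟩
  have hGc : ContinuousOn G U := by
    rw [continuousOn_iff_continuous_domRestrict]
    have : U.domRestrict G = fun w => (Γ w : ℂ) := funext hG
    rw [this]
    fun_prop
  have hGD : ∀ w ∈ U, G w ∈ D := fun w hw => by
    rw [hG ⟨w, hw⟩]; exact (Γ ⟨w, hw⟩).2
  have hfG : ∀ w ∈ U, f (G w) = Complex.exp w := fun w hw => by
    rw [hG ⟨w, hw⟩]
    exact congrArg Subtype.val (congrFun hΓ ⟨w, hw⟩)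
  -- Simple connectivity of `D` supplies a logarithm of `f`, which omits 0; it is needed for the
  -- injectivity of the lift.
  obtain ⟨L, hLc, hL⟩ := Complex.exists_continuousOn_eqOn_exp_comp hsc hD.isOpen
    hD.holomorphic.continuousOn (by
      rw [himg]
      intro h
      have h' : R < ‖(0 : ℂ)‖ := h
      rw [norm_zero] at h'
      exact lt_asymm hR h')
  have hinj : InjOn G U := injOn_of_exp_comp_eq hUo hUc hGc hGD hLc fun w hw => by
    rw [← hfG w hw]; exact hL (hGD w hw)
  refine ⟨a, G, ?_, hinj, fun w hw => ⟨hGD w hw, hfG w hw⟩⟩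
  exact differentiableOn_of_comp_eqOn (h := Complex.exp) hUo hD.isOpen hGc hinj hGD
    hD.holomorphic hfG Complex.differentiable_exp.differentiableOn
    (fun w _ => by simp [Complex.exp_ne_zero])

/-- Logarithmic coordinates in a logarithmic tract: `g` is the logarithm of a conformal inverse
branch of `f`. -/
lemma IsLogarithmicTract.exists_log_coordinate {f : ℂ → ℂ} {D : Set ℂ}
    (hD : IsLogarithmicTract f D) {p r : ℝ}
    (hr : ∀ z ∈ D, r ≤ ‖z‖ → ‖f z‖ ≤ Real.exp (Real.exp (Real.log ‖z‖ ^ p))) :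
    ∃ (a : ℝ) (g : ℂ → ℂ), DifferentiableOn ℂ g {w | a < w.re} ∧
      InjOn (fun w => Complex.exp (g w)) {w | a < w.re} ∧
      ∀ w : ℂ, a < w.re → Complex.exp (g w) ∈ D ∧ f (Complex.exp (g w)) = Complex.exp w ∧
        0 < (g w).re ∧ w.re ≤ Real.exp ((g w).re ^ p) := by
  obtain ⟨a₀, G, hGd, hGi, hG⟩ := hD.exists_inverse_branch
  set r' := max r 1
  have hcomp : IsCompact (closure D ∩ Metric.closedBall 0 r') :=
    (isCompact_closedBall 0 r').inter_left isClosed_closure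
  obtain ⟨M, hM⟩ := hcomp.exists_bound_of_continuousOn
    (hD.continuousOn.mono inter_subset_left)
  set a := max a₀ M
  have hsub : {w : ℂ | a < w.re} ⊆ {w | a₀ < w.re} := fun w hw =>
    (le_max_left a₀ M).trans_lt (show a < w.re from hw)
  -- Far to the right `G w` leaves every fixed disc, because `f` is bounded on compact parts of
  -- `closure D` while `|f (G w)| = exp (Re w)`.
  have hbig : ∀ w : ℂ, a < w.re → r' < ‖G w‖ := by
    intro w hw
    by_contra! h
    obtain ⟨h1, h2⟩ := hG w (hsub hw)
    have h3 := hM (G w) ⟨subset_closure h1, by simpa using h⟩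
    rw [h2, Complex.norm_exp] at h3
    have h4 := Real.add_one_le_exp w.re
    have h5 : M < w.re := lt_of_le_of_lt (le_max_right _ _) hw
    linarith
  obtain ⟨g, hgd, hg⟩ := exists_differentiableOn_log (isOpen_re_gt a) (convex_re_gt a)
    ⟨((a + 1 : ℝ) : ℂ), by simp⟩ (hGd.mono hsub) (fun w hw h0 => by
      have h1 := hbig w hw
      rw [h0, norm_zero] at h1
      have := le_max_right r 1
      change r' < 0 at h1
      linarith)
  refine ⟨a, g, hgd, ?_, fun w hw => ?_⟩
  · intro x hx y hy hxy
    simp only [hg x hx, hg y hy] at hxy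
    exact hGi (hsub hx) (hsub hy) hxy
  · have h1 := hbig w hw
    have h2 := hG w (hsub hw)
    rw [hg w hw]
    refine ⟨h2.1, h2.2, ?_, ?_⟩
    · rw [← hg w hw, Complex.norm_exp] at h1
      have h3 : (1 : ℝ) < Real.exp (g w).re := (le_max_right r 1).trans_lt h1
      exact Real.one_lt_exp_iff.1 h3
    · have h3 := hr _ h2.1 ((le_max_left r 1).trans h1.le)
      rw [h2.2, ← hg w hw, Complex.norm_exp, Complex.norm_exp, Real.log_exp] at h3
      exact Real.exp_le_exp.1 h3

/-! ### Steep crossings of a real function. -/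

/-- A continuous function passing from values at most `c` to values at least `d` crosses `(c, d)`
on some interval. -/
lemma exists_crossing_interval {v : ℝ → ℝ} {A B c d : ℝ} (hAB : A ≤ B)
    (hv : ContinuousOn v (Icc A B)) (hc : v A ≤ c) (hcd : c < d) (hd : d ≤ v B) :
    ∃ a b, A ≤ a ∧ a < b ∧ b ≤ B ∧ v a = c ∧ v b = d ∧ ∀ x ∈ Ioo a b, c < v x ∧ v x < d := by
  have hne : (Icc A B ∩ v ⁻¹' {d}).Nonempty := by
    obtain ⟨x, hx, hxd⟩ := intermediate_value_Icc hAB hv ⟨hc.trans hcd.le, hd⟩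
    exact ⟨x, hx, hxd⟩
  -- `b` is the first time the value `d` is taken, and `a` below is the last time before `b` that
  -- the value `c` is taken.
  obtain ⟨b, ⟨hb, hbd⟩, hbmin⟩ := (isCompact_Icc.of_isClosed_subset
    (hv.preimage_isClosed_of_isClosed isClosed_Icc isClosed_singleton)
    inter_subset_left).exists_isLeast hne
  have hbd : v b = d := hbd
  have hvb : ContinuousOn v (Icc A b) := hv.mono (Icc_subset_Icc_right hb.2)
  have hne' : (Icc A b ∩ v ⁻¹' {c}).Nonempty := by
    obtain ⟨x, hx, hxc⟩ := intermediate_value_Icc hb.1 hvb ⟨hc, hcd.le.trans hbd.ge⟩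
    exact ⟨x, hx, hxc⟩
  obtain ⟨a, ⟨ha, hac⟩, hamax⟩ := (isCompact_Icc.of_isClosed_subset
    (hvb.preimage_isClosed_of_isClosed isClosed_Icc isClosed_singleton)
    inter_subset_left).exists_isGreatest hne'
  have hac : v a = c := hac
  have hab : a < b := lt_of_le_of_ne ha.2 (by rintro rfl; linarith)
  refine ⟨a, b, ha.1, hab, hb.2, hac, hbd, fun x hx => ⟨?_, ?_⟩⟩
  · by_contra! h
    obtain ⟨y, hy, hyc⟩ := intermediate_value_Icc hx.2.le
      (hvb.mono (Icc_subset_Icc_left (ha.1.trans hx.1.le))) ⟨h, hcd.le.trans hbd.ge⟩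
    have := hamax ⟨⟨ha.1.trans (hx.1.le.trans hy.1), hy.2⟩, hyc⟩
    linarith [hx.1, hy.1]
  · by_contra! h
    obtain ⟨y, hy, hyd⟩ := intermediate_value_Icc (ha.1.trans hx.1.le)
      (hvb.mono (Icc_subset_Icc_right hx.2.le)) ⟨hc.trans hcd.le, h⟩
    have := hbmin ⟨⟨hy.1, hy.2.trans (hx.2.le.trans hb.2)⟩, hyd⟩
    linarith [hx.2, hy.2]

/-- A differentiable function increasing by `ρ` on `[A, B]` has derivative at least
`ρ / (4 (B - A))` at points whose values are well distributed. -/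
lemma exists_steep_points {v v' : ℝ → ℝ} {A B t ρ : ℝ} (hAB : A < B)
    (hv : ∀ x ∈ Icc A B, HasDerivAt v (v' x) x) (hρ : 0 < ρ) (hA : v A ≤ t) (hB : t + ρ ≤ v B)
    {M : ℕ} (hM : 0 < M) :
    ∃ J : Finset ℕ, (∀ j ∈ J, j < M) ∧ M ≤ 2 * J.card ∧ ∀ j ∈ J, ∃ ξ ∈ Icc A B,
      t + 2 * j * (ρ / (2 * M)) ≤ v ξ ∧ v ξ ≤ t + (2 * j + 1) * (ρ / (2 * M)) ∧
      ρ / (4 * (B - A)) ≤ v' ξ := by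
  classical
  -- The range of values is cut into `2M` strips of height `d`. Only every other strip is used; the
  -- skipped ones keep the chosen values apart.
  set d := ρ / (2 * M) with hd
  have hM' : (0 : ℝ) < M := by exact_mod_cast hM
  have hd0 : 0 < d := by positivity
  have hdM : d * (2 * M) = ρ := by rw [hd]; field_simp
  have hvc : ContinuousOn v (Icc A B) := fun x hx => (hv x hx).continuousAt.continuousWithinAt
  have hcross : ∀ j : ℕ, ∃ a b, j < M → A ≤ a ∧ a < b ∧ b ≤ B ∧ v a = t + 2 * j * d ∧
      v b = t + (2 * j + 1) * d ∧ ∀ x ∈ Ioo a b, t + 2 * j * d < v x ∧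
        v x < t + (2 * j + 1) * d := by
    intro j
    by_cases hj : j < M
    · have hj' : (j : ℝ) + 1 ≤ M := by exact_mod_cast hj
      obtain ⟨a, b, h⟩ := exists_crossing_interval (c := t + 2 * j * d)
        (d := t + (2 * j + 1) * d) hAB.le hvc
        (hA.trans (by have : 0 ≤ 2 * (j : ℝ) * d := by positivity
                      linarith)) (by linarith)
        (le_trans (by nlinarith) hB)
      exact ⟨a, b, fun _ => h⟩
    · exact ⟨0, 0, fun h => absurd h hj⟩
  choose a b hab using hcross
  have hdisj : Set.PairwiseDisjoint (↑(Finset.range M)) fun j => Ioo (a j) (b j) := by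
    have key : ∀ i j : ℕ, i < M → j < M → i < j → Disjoint (Ioo (a i) (b i)) (Ioo (a j) (b j)) := by
      intro i j hi hj hij
      rw [Set.disjoint_left]
      intro x hxi hxj
      have h1 := ((hab i hi).2.2.2.2.2 x hxi).2
      have h2 := ((hab j hj).2.2.2.2.2 x hxj).1
      have h3 : (i : ℝ) + 1 ≤ j := by exact_mod_cast hij
      nlinarith
    intro i hi j hj hij
    simp only [Finset.coe_range, mem_Iio] at hi hj
    rcases lt_or_gt_of_ne hij with h | h
    · exact key i j hi hj h
    · exact (key j i hj hi h).symm
  have hsum : ∑ j ∈ Finset.range M, (b j - a j) ≤ B - A := by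
    have h1 : volume (⋃ j ∈ Finset.range M, Ioo (a j) (b j)) ≤ volume (Icc A B) := by
      refine measure_mono (iUnion₂_subset fun j hj x hx => ?_)
      have h := hab j (Finset.mem_range.1 hj)
      exact ⟨h.1.trans hx.1.le, hx.2.le.trans h.2.2.1⟩
    rw [measure_biUnion_finset hdisj fun _ _ => measurableSet_Ioo] at h1
    simp only [Real.volume_Ioo, Real.volume_Icc] at h1
    rw [← ENNReal.ofReal_sum_of_nonneg fun j hj =>
      sub_nonneg.2 (hab j (Finset.mem_range.1 hj)).2.1.le] at h1
    exact (ENNReal.ofReal_le_ofReal_iff (by linarith)).1 h1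
  -- The crossing intervals are disjoint, so at most half of them exceed twice the average length
  -- `(B - A) / M`; on the others the mean value theorem gives the slope.
  set J := (Finset.range M).filter fun j => b j - a j ≤ 2 * (B - A) / M with hJ
  refine ⟨J, fun j hj => Finset.mem_range.1 (Finset.mem_filter.1 hj).1, ?_, fun j hj => ?_⟩
  · set J' := (Finset.range M).filter fun j => ¬ b j - a j ≤ 2 * (B - A) / M with hJ'
    have h1 : J.card + J'.card = M := by
      rw [hJ, hJ', Finset.card_filter_add_card_filter_not, Finset.card_range]
    have h2 : J'.card * (2 * (B - A) / M) ≤ B - A := by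
      calc J'.card * (2 * (B - A) / M) = ∑ j ∈ J', 2 * (B - A) / M := by
            rw [Finset.sum_const, nsmul_eq_mul]
        _ ≤ ∑ j ∈ J', (b j - a j) := Finset.sum_le_sum fun j hj =>
            (not_le.1 (Finset.mem_filter.1 hj).2).le
        _ ≤ ∑ j ∈ Finset.range M, (b j - a j) :=
            Finset.sum_le_sum_of_subset_of_nonneg (Finset.filter_subset _ _) fun j hj _ =>
              sub_nonneg.2 (hab j (Finset.mem_range.1 hj)).2.1.le
        _ ≤ B - A := hsum
    have h3 : (2 * J'.card : ℝ) ≤ M := by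
      have h4 : (J'.card : ℝ) * (2 * (B - A) / M) = (2 * J'.card) * (B - A) / M := by ring
      rw [h4, div_le_iff₀ hM', mul_comm (B - A)] at h2
      exact le_of_mul_le_mul_right h2 (sub_pos.2 hAB)
    have h5 : 2 * J'.card ≤ M := by exact_mod_cast h3
    omega
  · obtain ⟨hjM, hj⟩ := Finset.mem_filter.1 hj
    obtain ⟨hAa, hlt, hbB, hva, hvb, hx⟩ := hab j (Finset.mem_range.1 hjM)
    have hsub : Icc (a j) (b j) ⊆ Icc A B := Icc_subset_Icc hAa hbB
    obtain ⟨ξ, hξ, hξ'⟩ := exists_hasDerivAt_eq_slope v v' hlt (hvc.mono hsub)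
      fun x hx => hv x (hsub (Ioo_subset_Icc_self hx))
    refine ⟨ξ, hsub (Ioo_subset_Icc_self hξ), (hx ξ hξ).1.le, (hx ξ hξ).2.le, ?_⟩
    rw [hξ', hva, hvb, show t + (2 * j + 1) * d - (t + 2 * j * d) = d by ring,
      div_le_div_iff₀ (by linarith) (by linarith)]
    rw [le_div_iff₀ hM'] at hj
    nlinarith

/-- A finite set of natural numbers of diameter at most `d` has at most `d + 1` elements. -/
lemma card_le_of_forall_sub_le {F : Finset ℕ} {d : ℝ} (hd : 0 ≤ d)
    (h : ∀ i ∈ F, ∀ j ∈ F, (j : ℝ) - i ≤ d) : (F.card : ℝ) ≤ d + 1 := by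
  rcases F.eq_empty_or_nonempty with rfl | hF
  · simp; linarith
  have h1 : F ⊆ Finset.Icc (F.min' hF) (F.max' hF) := fun i hi =>
    Finset.mem_Icc.2 ⟨F.min'_le i hi, F.le_max' i hi⟩
  have h2 := Finset.card_le_card h1
  rw [Nat.card_Icc] at h2
  have h3 := h _ (F.min'_mem hF) _ (F.max'_mem hF)
  have h4 : F.min' hF ≤ F.max' hF := F.min'_le _ (F.max'_mem hF)
  have h5 : (F.card : ℝ) ≤ ((F.max' hF + 1 - F.min' hF : ℕ) : ℝ) := by exact_mod_cast h2
  rw [Nat.cast_sub (by omega)] at h5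
  push_cast at h5
  linarith

/-! ### Distortion and growth of the logarithmic coordinate. -/

/-- `g` is the logarithm of a conformal map of the half-plane `Re w > a`, and its real part is at
least `(log Re w) ^ (1 / p)`. -/
structure IsTractLog (g : ℂ → ℂ) (a p : ℝ) : Prop where
  one_le : 1 ≤ a
  differentiableOn : DifferentiableOn ℂ g {w | a < w.re}
  injOn : InjOn (fun w => Complex.exp (g w)) {w | a < w.re}
  growth : ∀ w : ℂ, a < w.re → 0 < (g w).re ∧ w.re ≤ Real.exp ((g w).re ^ p)

/-- The relative radius of discs on which the distortion of a conformal map of a half-plane is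
controlled. -/
noncomputable def distortionRadius : ℝ := 1 / (1280 * 672 ^ 2)

lemma distortionRadius_pos : 0 < distortionRadius := by
  unfold distortionRadius; positivity

lemma distortionRadius_le : distortionRadius ≤ 1 / 6 := by
  unfold distortionRadius; norm_num

namespace IsTractLog

variable {g : ℂ → ℂ} {a p : ℝ}

lemma ball_subset {x : ℝ} (hx : 2 * a ≤ x) :
    Metric.ball (x : ℂ) (x / 2) ⊆ {w | a < w.re} := by
  intro w hw
  rw [mem_ball_iff_norm'] at hw
  have h1 := (le_abs_self _).trans (Complex.abs_re_le_norm ((x : ℂ) - w))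
  rw [Complex.sub_re, Complex.ofReal_re] at h1
  change a < w.re
  linarith

lemma closedBall_subset (hg : IsTractLog g a p) {x : ℝ} (hx : 2 * a ≤ x) :
    Metric.closedBall (x : ℂ) (distortionRadius * x) ⊆ Metric.ball (x : ℂ) (x / 2) := by
  have := hg.one_le
  exact Metric.closedBall_subset_ball (by nlinarith [distortionRadius_le])

/-- The disc of radius `x / 2` about `x` lies in the half-plane; `1344 = 2 * 672`. -/
lemma norm_deriv_mul_le (hg : IsTractLog g a p) {x : ℝ} (hx : 2 * a ≤ x) :
    ‖deriv g x‖ * x ≤ 1344 := by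
  have := hg.one_le
  have h := norm_deriv_mul_le_of_exp_injOn (by linarith)
    (hg.differentiableOn.mono (ball_subset hx)) (hg.injOn.mono (ball_subset hx))
  linarith

lemma norm_sub_sub_mul_le (hg : IsTractLog g a p) {x : ℝ} (hx : 2 * a ≤ x)
    (h0 : deriv g x ≠ 0) {w w' : ℂ}
    (hw : w ∈ Metric.closedBall (x : ℂ) (distortionRadius * x))
    (hw' : w' ∈ Metric.closedBall (x : ℂ) (distortionRadius * x)) :
    ‖g w - g w' - deriv g x * (w - w')‖ ≤ ‖deriv g x‖ / 2 * ‖w - w'‖ := by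
  have ha := hg.one_le
  have hsub := ball_subset hx
  refine norm_sub_sub_mul_le_of_norm_deriv_sub_le (convex_closedBall _ _) (fun z hz => ?_)
    (fun z hz => ?_) hw hw'
  · exact hg.differentiableOn.differentiableAt ((isOpen_re_gt a).mem_nhds
      (hsub (hg.closedBall_subset hx hz)))
  · refine norm_deriv_sub_le_of_injOn (by linarith) (hg.differentiableOn.mono hsub)
      (fun y hy z hz hyz => hg.injOn (hsub hy) (hsub hz) (congrArg Complex.exp hyz)) h0 ?_
    -- Koebe distortion on a disc of radius `x / 2` allows the radius `x / (640 * 672 ^ 2)`; half of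
    -- that is used.
    refine Metric.closedBall_subset_ball ?_ hz
    unfold distortionRadius
    rw [div_mul_eq_mul_div, one_mul, div_div, div_lt_div_iff₀ (by norm_num) (by norm_num)]
    linarith

lemma norm_sub_le (hg : IsTractLog g a p) {x : ℝ} (hx : 2 * a ≤ x)
    (h0 : deriv g x ≠ 0) {w w' : ℂ}
    (hw : w ∈ Metric.closedBall (x : ℂ) (distortionRadius * x))
    (hw' : w' ∈ Metric.closedBall (x : ℂ) (distortionRadius * x)) :
    ‖g w - g w'‖ ≤ 3 / 2 * ‖deriv g x‖ * ‖w - w'‖ := by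
  have h1 := hg.norm_sub_sub_mul_le hx h0 hw hw'
  calc ‖g w - g w'‖ = ‖(g w - g w' - deriv g x * (w - w')) + deriv g x * (w - w')‖ := by ring_nf
    _ ≤ _ := norm_add_le _ _
    _ ≤ ‖deriv g x‖ / 2 * ‖w - w'‖ + ‖deriv g x‖ * ‖w - w'‖ := by rw [norm_mul]; gcongr
    _ = _ := by ring

lemma le_norm_sub (hg : IsTractLog g a p) {x : ℝ} (hx : 2 * a ≤ x)
    (h0 : deriv g x ≠ 0) {w w' : ℂ}
    (hw : w ∈ Metric.closedBall (x : ℂ) (distortionRadius * x))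
    (hw' : w' ∈ Metric.closedBall (x : ℂ) (distortionRadius * x)) :
    1 / 2 * ‖deriv g x‖ * ‖w - w'‖ ≤ ‖g w - g w'‖ := by
  have h1 := hg.norm_sub_sub_mul_le hx h0 hw hw'
  have h2 : ‖deriv g x * (w - w')‖ ≤ ‖g w - g w'‖ + ‖g w - g w' - deriv g x * (w - w')‖ := by
    calc ‖deriv g x * (w - w')‖ = ‖(g w - g w') - (g w - g w' - deriv g x * (w - w'))‖ := by
          ring_nf
      _ ≤ _ := _root_.norm_sub_le _ _
  rw [norm_mul] at h2
  linarith

lemma two_mul_le_exp (hg : IsTractLog g a p) {L : ℝ} (hL : Real.log (2 * a) ≤ L) :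
    2 * a ≤ Real.exp L := by
  have := hg.one_le
  exact (Real.log_le_iff_le_exp (by linarith)).1 hL

lemma lt_exp (hg : IsTractLog g a p) {L : ℝ} (hL : Real.log (2 * a) ≤ L) :
    a < ((Real.exp L : ℝ) : ℂ).re := by
  have := hg.one_le
  have := hg.two_mul_le_exp hL
  rw [Complex.ofReal_re]
  linarith

lemma hasDerivAt_re (hg : IsTractLog g a p) {L : ℝ} (hL : Real.log (2 * a) ≤ L) :
    HasDerivAt (fun L : ℝ => (g (Real.exp L : ℝ)).re)
      (deriv g (Real.exp L : ℝ) * (Real.exp L : ℝ)).re L := by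
  have h1 : HasDerivAt g (deriv g (Real.exp L : ℝ)) ((Real.exp L : ℝ) : ℂ) :=
    (hg.differentiableOn.differentiableAt ((isOpen_re_gt a).mem_nhds (hg.lt_exp hL))).hasDerivAt
  have h2 : HasDerivAt (fun L : ℝ => g (Real.exp L : ℝ))
      (deriv g (Real.exp L : ℝ) * (Real.exp L : ℝ)) L :=
    HasDerivAt.comp L h1 (Real.hasDerivAt_exp L).ofReal_comp
  exact Complex.reCLM.hasFDerivAt.comp_hasDerivAt L h2

lemma re_deriv_le {L : ℝ} :
    (deriv g (Real.exp L : ℝ) * (Real.exp L : ℝ)).re ≤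
      ‖deriv g (Real.exp L : ℝ)‖ * Real.exp L := by
  refine (Complex.re_le_norm _).trans_eq ?_
  rw [norm_mul, Complex.norm_real, Real.norm_eq_abs, abs_of_pos (Real.exp_pos L)]

/-- The real part of `g` grows at most linearly in `log x`. -/
lemma re_le (hg : IsTractLog g a p) {L : ℝ} (hL : Real.log (2 * a) ≤ L) :
    (g (Real.exp L : ℝ)).re ≤
      (g (Real.exp (Real.log (2 * a)) : ℝ)).re + 1344 * (L - Real.log (2 * a)) := by
  have h := (convex_Icc (Real.log (2 * a)) L).image_sub_le_mul_sub_of_deriv_le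
    (f := fun L : ℝ => (g (Real.exp L : ℝ)).re) (C := 1344)
    (fun x hx => (hg.hasDerivAt_re hx.1).continuousAt.continuousWithinAt)
    (fun x hx => (hg.hasDerivAt_re
      (interior_subset hx).1).differentiableAt.differentiableWithinAt)
    (fun x hx => by
      have hx' := (interior_subset hx).1
      rw [(hg.hasDerivAt_re hx').deriv]
      exact re_deriv_le.trans (hg.norm_deriv_mul_le (hg.two_mul_le_exp hx')))
    _ (left_mem_Icc.2 hL) _ (right_mem_Icc.2 hL) hL
  linarith

lemma le_re_rpow (hg : IsTractLog g a p) {L : ℝ} (hL : Real.log (2 * a) ≤ L) :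
    0 < (g (Real.exp L : ℝ)).re ∧ L ≤ (g (Real.exp L : ℝ)).re ^ p := by
  obtain ⟨h1, h2⟩ := hg.growth _ (hg.lt_exp hL)
  exact ⟨h1, Real.exp_le_exp.1 h2⟩

/-- The growth exponent of a logarithmic tract is at least one. -/
lemma one_le_exponent (hg : IsTractLog g a p) (hp : 0 < p) : 1 ≤ p := by
  by_contra! hp1
  set v₀ := (g (Real.exp (Real.log (2 * a)) : ℝ)).re
  have hlog : 0 ≤ Real.log (2 * a) := Real.log_nonneg (by linarith [hg.one_le])
  have h1 : ∀ᶠ L in atTop, (1345 : ℝ) ^ p < L ^ (1 - p) :=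
    (tendsto_rpow_atTop (by linarith : 0 < 1 - p)).eventually_gt_atTop _
  obtain ⟨L, hL, hL1, hL2, hL3⟩ := (h1.and ((eventually_ge_atTop (Real.log (2 * a))).and
    ((eventually_ge_atTop v₀).and (eventually_gt_atTop 0)))).exists
  obtain ⟨h2, h3⟩ := hg.le_re_rpow hL1
  have h4 := hg.re_le hL1
  -- `Re g(e^L)` is at most linear in `L`, so `L ≤ (Re g(e^L)) ^ p` fails for large `L` when `p <
  -- 1`.
  have h5 : L ≤ (1345 * L) ^ p := h3.trans (Real.rpow_le_rpow h2.le (by linarith) hp.le)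
  rw [Real.mul_rpow (by norm_num) hL3.le] at h5
  have h6 : L = L ^ p * L ^ (1 - p) := by
    rw [← Real.rpow_add hL3, add_sub_cancel, Real.rpow_one]
  have h7 : 0 < L ^ p := Real.rpow_pos_of_pos hL3 p
  nlinarith

end IsTractLog

/-! ### Nodes and the choice of their children. -/

/-- Thresholds for the construction of the tree of discs. -/
lemma exists_threshold (a p θ v₀ C : ℝ) (hp : 1 ≤ p) (hθ : θ < 1) :
    ∃ X₀ : ℝ, ∀ X ≥ X₀, 2 * a ≤ X ∧ 1 ≤ X ∧ Real.log (2 * a) < (2 * X) ^ p ∧ v₀ ≤ X / 2 ∧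
      ∀ x, Real.exp ((X / 2 - v₀) / 1344) ≤ x → X + 1 ≤ x ∧ C * (2 * X) ^ p ≤ x ^ (1 - θ) := by
  -- By `IsTractLog.re_le`, this exponential bounds from below every relevant `x` with `Re g(x) ≥ X
  -- / 2`; so children lie exponentially far to the right.
  have hlin : Tendsto (fun X : ℝ => (X / 2 - v₀) / 1344) atTop atTop := by
    refine Tendsto.atTop_div_const (by norm_num) ?_
    exact tendsto_atTop_add_const_right _ _ (tendsto_id.atTop_div_const (by norm_num))
  have h2X : Tendsto (fun X : ℝ => 2 * X) atTop atTop :=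
    tendsto_id.const_mul_atTop (by norm_num)
  have h1 : ∀ᶠ X : ℝ in atTop, X + 1 ≤ Real.exp ((X / 2 - v₀) / 1344) := by
    have h := (Real.tendsto_exp_div_pow_atTop 1).eventually_ge_atTop (2 * 1344 * 2 + 1)
    filter_upwards [hlin.eventually h, hlin.eventually_ge_atTop (|v₀| + 1)] with X hX hX'
    have h0 : 0 < (X / 2 - v₀) / 1344 := by linarith [abs_nonneg v₀]
    rw [pow_one, le_div_iff₀ h0] at hX
    refine le_trans ?_ hX
    have := le_abs_self v₀
    have := neg_abs_le v₀
    linarith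
  have h2 : ∀ᶠ X : ℝ in atTop,
      C * (2 * X) ^ p ≤ Real.exp ((X / 2 - v₀) / 1344) ^ (1 - θ) := by
    have hk : (0 : ℝ) < (1 - θ) / (4 * 1344) := by
      have : 0 < 1 - θ := by linarith
      positivity
    have h := (isLittleO_rpow_exp_pos_mul_atTop p hk).bound
      (c := Real.exp (-(v₀ * (1 - θ) / 1344)) / (|C| + 1)) (by positivity)
    filter_upwards [h2X.eventually h, eventually_ge_atTop 0] with X hX hX0
    have h3 : (0 : ℝ) ≤ (2 * X) ^ p := Real.rpow_nonneg (by linarith) p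
    rw [Real.norm_of_nonneg h3, Real.norm_of_nonneg (Real.exp_pos _).le, div_mul_eq_mul_div,
      le_div_iff₀ (by positivity), ← Real.exp_add] at hX
    rw [← Real.exp_mul]
    calc C * (2 * X) ^ p ≤ (|C| + 1) * (2 * X) ^ p := by
          gcongr; linarith [le_abs_self C]
      _ = (2 * X) ^ p * (|C| + 1) := by ring
      _ ≤ _ := hX
      _ = _ := by congr 1; ring
  have h3 : ∀ᶠ X : ℝ in atTop, Real.log (2 * a) < (2 * X) ^ p :=
    ((tendsto_rpow_atTop (by linarith)).comp h2X).eventually_gt_atTop _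
  obtain ⟨X₀, hX₀⟩ := eventually_atTop.1 (h1.and (h2.and (h3.and
    ((eventually_ge_atTop (2 * a)).and ((eventually_ge_atTop 1).and
      (eventually_ge_atTop (2 * v₀)))))))
  refine ⟨X₀, fun X hX => ?_⟩
  obtain ⟨h1, h2, h3, h4, h5, h6⟩ := hX₀ X hX
  refine ⟨h4, h5, h3, by linarith, fun x hx => ⟨h1.trans hx, h2.trans ?_⟩⟩
  exact Real.rpow_le_rpow (Real.exp_pos _).le hx (by linarith)

/-- The discs with centre `X` and radius `ρ` which serve as nodes of the tree. -/
structure IsNode (X₀ p s X ρ : ℝ) : Prop where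
  le_center : X₀ ≤ X
  le_radius : 80 * (8 / distortionRadius) ^ s * (2 * X) ^ (p * (s - 1)) ≤ ρ
  radius_le : ρ ≤ distortionRadius * X

/-- The threshold `X₀` is large enough for the construction of the tree of discs. -/
def IsThreshold (g : ℂ → ℂ) (a p s X₀ : ℝ) : Prop :=
  ∀ X ≥ X₀, 2 * a ≤ X ∧ 1 ≤ X ∧ Real.log (2 * a) < (2 * X) ^ p ∧
    (g (Real.exp (Real.log (2 * a)) : ℝ)).re ≤ X / 2 ∧
    ∀ x, Real.exp ((X / 2 - (g (Real.exp (Real.log (2 * a)) : ℝ)).re) / 1344) ≤ x →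
      X + 1 ≤ x ∧ 2 ^ (p * (s - 1)) * (5376 / distortionRadius) * (2 * X) ^ p ≤
        x ^ (1 - p * (s - 1))

/-- An increasing enumeration of a finite set of natural numbers, continued arbitrarily. -/
lemma exists_enumeration {J : Finset ℕ} (hJ : 0 < J.card) :
    ∃ e : ℕ → ℕ, (∀ j, e j ∈ J) ∧ ∀ i k, i + k < J.card → e i + k ≤ e (i + k) := by
  set n := J.card
  refine ⟨fun j => J.orderEmbOfFin rfl ⟨min j (n - 1), by omega⟩,
    fun j => J.orderEmbOfFin_mem rfl _, fun i k hik => ?_⟩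
  induction k with
  | zero => rfl
  | succ k ih =>
    have h1 := ih (by omega)
    have h2 : J.orderEmbOfFin rfl ⟨min (i + k) (n - 1), by omega⟩ <
        J.orderEmbOfFin rfl ⟨min (i + (k + 1)) (n - 1), by omega⟩ := by
      apply (J.orderEmbOfFin rfl).strictMono
      rw [Fin.mk_lt_mk]
      omega
    simp only at h1 ⊢
    omega

lemma IsNode.eighty_le {X₀ p s X ρ : ℝ} (h : IsNode X₀ p s X ρ) (hX : 1 ≤ X) (hp : 1 ≤ p)
    (hs : 1 < s) : 80 * (2 * X) ^ (p * (s - 1)) ≤ ρ ∧ 80 ≤ ρ := by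
  have h1 : 1 ≤ (8 / distortionRadius) ^ s := by
    apply Real.one_le_rpow _ (by linarith)
    rw [le_div_iff₀ distortionRadius_pos]
    linarith [distortionRadius_le]
  have h2 : 1 ≤ (2 * X) ^ (p * (s - 1)) :=
    Real.one_le_rpow (by linarith) (by nlinarith)
  have h3 := h.le_radius
  have h4 : 80 * 1 * (2 * X) ^ (p * (s - 1)) ≤
      80 * (8 / distortionRadius) ^ s * (2 * X) ^ (p * (s - 1)) := by gcongr
  constructor <;> linarith

/-- The child radius `κ (ρ / (4Λ)) / D` is at least `κρx / (5376Λ)`, with `5376 = 4 * 1344`, and so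
exceeds `c (2x)^θ` for large `x`. This makes the children nodes again. -/
lemma mul_two_mul_rpow_le {κ x θ c ρ Λ D : ℝ} (hκ : 0 < κ) (hx : 0 < x) (hΛ : 0 < Λ)
    (hD : 0 < D) (hρ : 0 < ρ) (hc : c ≤ ρ)
    (hbig : 2 ^ θ * (5376 / κ) * Λ ≤ x ^ (1 - θ)) (hDx : D * x ≤ 1344) :
    c * (2 * x) ^ θ ≤ κ * (ρ / (4 * Λ) / D) := by
  have h2θ : (0 : ℝ) < 2 ^ θ := Real.rpow_pos_of_pos (by norm_num) θ
  have hxθ : 0 < (2 * x) ^ θ := Real.rpow_pos_of_pos (by linarith) θ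
  have h1 : (2 * x) ^ θ * x ^ (1 - θ) = 2 ^ θ * x := by
    rw [Real.mul_rpow (by norm_num) hx.le, mul_assoc, ← Real.rpow_add hx,
      add_sub_cancel, Real.rpow_one]
  have h3 : (2 * x) ^ θ * (2 ^ θ * (5376 / κ) * Λ) ≤ 2 ^ θ * x := by
    rw [← h1]; gcongr
  have h4 : (2 : ℝ) ^ θ * ((2 * x) ^ θ * (5376 / κ) * Λ) ≤ 2 ^ θ * x := by
    linarith
  have h5 := le_of_mul_le_mul_left h4 h2θ
  have h6 : (2 * x) ^ θ * (5376 * Λ) ≤ κ * x := by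
    have h7 : (2 * x) ^ θ * (5376 / κ) * Λ = (2 * x) ^ θ * (5376 * Λ) / κ := by ring
    rw [h7, div_le_iff₀ hκ] at h5
    linarith
  have h8 : x / 1344 ≤ 1 / D := by
    rw [div_le_div_iff₀ (by norm_num) hD]
    linarith
  calc c * (2 * x) ^ θ ≤ ρ * (2 * x) ^ θ := by gcongr
    _ = ρ * ((2 * x) ^ θ * (5376 * Λ)) / (5376 * Λ) := by field_simp
    _ ≤ ρ * (κ * x) / (5376 * Λ) := by gcongr
    _ = κ * (ρ / (4 * Λ) * (x / 1344)) := by field_simp; norm_num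
    _ ≤ κ * (ρ / (4 * Λ) * (1 / D)) := by gcongr
    _ = κ * (ρ / (4 * Λ) / D) := by ring

/-- The children of the node with centre `X` and radius `ρ` are arranged in `n` columns of `K`
translates each. The discs of the children in column `j` have centre `x j` and radius `y j`, and
different columns are at distance at least `d`, up to a constant. -/
structure IsChildren (g : ℂ → ℂ) (p s X₀ X ρ : ℝ) (n K : ℕ) (x y : ℕ → ℝ) (d : ℝ) : Prop where
  num_pos : 0 < n
  two_le : 2 ≤ K
  le_div : (K : ℝ) ≤ ρ / 10
  le_mul : (2 * X) ^ p * ρ / 80 ≤ n * K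
  sep_pos : 0 < d
  sep_le : d ≤ 1
  le_sep : ρ / (2 * (2 * X) ^ p) ≤ d
  child : ∀ j, IsNode X₀ p s (x j) (y j) ∧ X + 1 ≤ x j ∧ 0 < y j ∧ deriv g (x j) ≠ 0 ∧
    ‖deriv g (x j)‖ * y j = distortionRadius * (ρ / (4 * (2 * X) ^ p)) ∧
    X - ρ / 2 ≤ (g (x j)).re ∧ (g (x j)).re ≤ X + ρ / 2
  sep : ∀ i k, i + k < n → d * (2 * k - 1) ≤ (g (x (i + k))).re - (g (x i)).re

set_option maxHeartbeats 400000 in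
/-- The real centres and the radii of the children of a node. -/
lemma IsTractLog.exists_children {g : ℂ → ℂ} {a p s X₀ X ρ : ℝ} (hg : IsTractLog g a p)
    (hp : 1 ≤ p) (hs : 1 < s) (hX₀ : IsThreshold g a p s X₀) (h : IsNode X₀ p s X ρ) :
    ∃ (n K : ℕ) (x y : ℕ → ℝ) (d : ℝ), IsChildren g p s X₀ X ρ n K x y d := by
  obtain ⟨haX, hX1, hlog, hv₀, hbig⟩ := hX₀ X h.le_center
  obtain ⟨h80, hρ80⟩ := h.eighty_le hX1 hp hs
  have hκ := distortionRadius_pos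
  have hκ6 := distortionRadius_le
  have hρX := h.radius_le
  have hlog0 : 0 ≤ Real.log (2 * a) := Real.log_nonneg (by linarith [hg.one_le])
  set Λ := (2 * X) ^ p with hΛ
  set θ := p * (s - 1) with hθ
  set v₀ := (g (Real.exp (Real.log (2 * a)) : ℝ)).re with hv₀def
  have hΛX : 2 * X ≤ Λ := by
    calc 2 * X = (2 * X) ^ (1 : ℝ) := (Real.rpow_one _).symm
      _ ≤ Λ := Real.rpow_le_rpow_of_exponent_le (by linarith) hp
  have hΛ0 : 0 < Λ := by linarith
  have hXρ : ρ ≤ X := by nlinarith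
  set M := ⌊Λ⌋₊ with hM
  have hM0 : 0 < M := Nat.floor_pos.2 (by linarith)
  have hMΛ : (M : ℝ) ≤ Λ := Nat.floor_le hΛ0.le
  have hM2 : Λ / 2 ≤ M := by
    have := Nat.lt_floor_add_one Λ
    rw [← hM] at this
    linarith
  have hM0' : (0 : ℝ) < M := by exact_mod_cast hM0
  -- At `L = Λ = (2X)^p` the growth bound forces `Re g(e^L) ≥ 2X`, so the whole window `[X - ρ/2, X
  -- + ρ/2]` is crossed before `Λ`.
  obtain ⟨J, hJM, hJcard, hJ⟩ := exists_steep_points (v := fun L : ℝ => (g (Real.exp L : ℝ)).re)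
    (A := Real.log (2 * a)) (B := Λ) (t := X - ρ / 2) (ρ := ρ) hlog
    (fun x hx => hg.hasDerivAt_re hx.1) (by linarith) (by linarith)
    (by
      obtain ⟨h1, h2⟩ := hg.le_re_rpow hlog.le
      have h3 : 2 * X ≤ (g (Real.exp Λ : ℝ)).re :=
        (Real.rpow_le_rpow_iff (by linarith) h1.le (by linarith)).1 h2
      linarith) hM0
  have hn : 0 < J.card := by omega
  have hn2 : (M : ℝ) / 2 ≤ J.card := by
    have : (M : ℝ) ≤ 2 * J.card := by exact_mod_cast hJcard
    linarith
  obtain ⟨e, heJ, he⟩ := exists_enumeration hn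
  choose ξ hξ using fun j => hJ (e j) (heJ j)
  set d := ρ / (2 * M) with hd
  have hd0 : 0 < d := by positivity
  set δ := ρ / (4 * Λ) with hδ
  have hδ0 : 0 < δ := by positivity
  have hκδ : δ ≤ ρ / (4 * (Λ - Real.log (2 * a))) := by
    apply div_le_div_of_nonneg_left (by linarith) (by linarith) (by linarith)
  have hlam : ∀ j, δ ≤ ‖deriv g (Real.exp (ξ j) : ℝ)‖ * Real.exp (ξ j) := fun j =>
    hκδ.trans ((hξ j).2.2.2.trans IsTractLog.re_deriv_le)
  have hval : ∀ j, X - ρ / 2 ≤ (g (Real.exp (ξ j) : ℝ)).re ∧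
      (g (Real.exp (ξ j) : ℝ)).re ≤ X + ρ / 2 := by
    intro j
    obtain ⟨-, h1, h2, -⟩ := hξ j
    refine ⟨le_trans ?_ h1, h2.trans ?_⟩
    · have : (0 : ℝ) ≤ 2 * e j * d := by positivity
      linarith
    · have h3 : (e j : ℝ) + 1 ≤ M := by exact_mod_cast hJM _ (heJ j)
      have h4 : (2 * (e j : ℝ) + 1) * d ≤ (2 * M) * d := by gcongr; linarith
      have h5 : (2 * M) * d = ρ := by rw [hd]; field_simp
      linarith
  have hexp : ∀ j, Real.exp ((X / 2 - v₀) / 1344) ≤ Real.exp (ξ j) := by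
    intro j
    apply Real.exp_le_exp.2
    have h1 := hg.re_le (hξ j).1.1
    rw [← hv₀def] at h1
    rw [div_le_iff₀ (by norm_num)]
    linarith [(hval j).1]
  -- A tenth of `ρ` rows spaced by `2π` fits into height `ρ`. Dividing by `|g'|` in the radius gives
  -- all images of children comparable size. The count is at least `(Λ / 4) (ρ / 20)`.
  refine ⟨J.card, ⌊ρ / 10⌋₊, fun j => Real.exp (ξ j),
    fun j => distortionRadius * (δ / ‖deriv g (Real.exp (ξ j) : ℝ)‖), d, hn,
    Nat.le_floor (by push_cast; linarith), Nat.floor_le (by linarith), ?_, hd0, ?_, ?_,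
    fun j => ?_, fun i k hik => ?_⟩
  · have h1 : ρ / 20 ≤ (⌊ρ / 10⌋₊ : ℝ) := by
      have := Nat.lt_floor_add_one (ρ / 10)
      linarith
    calc Λ * ρ / 80 = (Λ / 2 / 2) * (ρ / 20) := by ring
      _ ≤ J.card * (⌊ρ / 10⌋₊ : ℝ) := by
        gcongr
        linarith
  · rw [hd, div_le_one (by positivity)]
    linarith
  · rw [hd]
    apply div_le_div_of_nonneg_left (by linarith) (by positivity) (by linarith)
  · have hx0 := Real.exp_pos (ξ j)
    obtain ⟨hXx, hxbig⟩ := hbig _ (hexp j)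
    set x := Real.exp (ξ j) with hx
    set D := ‖deriv g (x : ℝ)‖ with hD
    have hlamj : δ ≤ D * x := hlam j
    have hD0 : 0 < D := by
      by_contra! hD0
      nlinarith
    have hlam2 : D * x ≤ 1344 := hg.norm_deriv_mul_le (by linarith)
    refine ⟨⟨by linarith [h.le_center], ?_, ?_⟩, hXx, by positivity, ?_, ?_, hval j⟩
    · have h2 : (1 : ℝ) ≤ (2 * X) ^ θ := Real.one_le_rpow (by linarith) (by
        rw [hθ]; nlinarith)
      have hc0 : 0 < 80 * (8 / distortionRadius) ^ s := by positivity
      have hcρ : 80 * (8 / distortionRadius) ^ s ≤ ρ := by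
        have := h.le_radius
        nlinarith
      exact mul_two_mul_rpow_le hκ hx0 hΛ0 hD0 (hc0.trans_le hcρ) hcρ hxbig hlam2
    · have : δ / D ≤ x := by rw [div_le_iff₀ hD0]; linarith
      exact mul_le_mul_of_nonneg_left this hκ.le
    · exact norm_pos_iff.1 hD0
    · change D * (distortionRadius * (δ / D)) = distortionRadius * δ
      field_simp
  · have h1 : (e i : ℝ) + k ≤ e (i + k) := by exact_mod_cast he i k hik
    have h2 := (hξ (i + k)).2.1
    have h3 := (hξ i).2.2.1
    have h4 : d * (2 * k - 1) ≤ d * (2 * ((e (i + k) : ℝ) - e i) - 1) :=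
      mul_le_mul_of_nonneg_left (by linarith) hd0.le
    have h5 : d * (2 * ((e (i + k) : ℝ) - e i) - 1) =
        (X - ρ / 2 + 2 * e (i + k) * d) - (X - ρ / 2 + (2 * e i + 1) * d) := by ring
    exact h4.trans (h5.trans_le (sub_le_sub h2 h3))

/-- Mass balance: `N` children whose images have size about `κρ / (8Λ)` carry at least the
`s`-dimensional mass `ρ ^ s` of the parent. This explains the lower bound on `ρ` in `IsNode`; the 8
includes the distortion factor 2. -/
lemma rpow_le_mul_rpow {κ Λ ρ s N : ℝ} (hκ : 0 < κ) (hΛ : 0 < Λ) (hρ : 0 < ρ)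
    (h : 80 * (8 / κ) ^ s * Λ ^ (s - 1) ≤ ρ) (hN : Λ * ρ / 80 ≤ N) :
    ρ ^ s ≤ N * (κ * (ρ / (8 * Λ))) ^ s := by
  have h1 : κ * (ρ / (8 * Λ)) = ρ / ((8 / κ) * Λ) := by field_simp
  have hc : 0 < (8 / κ) ^ s := by positivity
  have hΛs : 0 < Λ ^ s := by positivity
  have hρs : 0 < ρ ^ s := by positivity
  rw [h1, Real.div_rpow hρ.le (by positivity), Real.mul_rpow (by positivity) hΛ.le]
  have h2 : Λ ^ s = Λ * Λ ^ (s - 1) := by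
    rw [Real.rpow_sub hΛ, Real.rpow_one]; field_simp
  rw [mul_div_assoc', le_div_iff₀ (by positivity), mul_comm]
  gcongr
  refine le_trans ?_ hN
  rw [h2]
  have : Λ * (80 * (8 / κ) ^ s * Λ ^ (s - 1)) ≤ Λ * ρ := by gcongr
  linarith

/-- Compares the number of children within distance `r`, about `r / d` columns times `r + 2` rows,
with the share `(r / ρ)^s` of all children. The constant is `3200 = 80 * 10 * 4`. -/
lemma mul_mul_rpow_le {Λ ρ s N d r : ℝ} (hΛ : 1 ≤ Λ) (hρ : 0 < ρ) (hs1 : 1 < s) (hs2 : s ≤ 2)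
    (h : 80 * Λ ^ (s - 1) ≤ ρ) (hN : Λ * ρ / 80 ≤ N) (hd : 0 < d) (hd' : ρ / (2 * Λ) ≤ d)
    (hdr : d / 2 ≤ r) (hr : r ≤ 2 * ρ) :
    (r / d + 2) * (r + 2) * (ρ ^ s / 3200) ≤ N * r ^ s := by
  have hr0 : 0 < r := by linarith
  have hΛ0 : 0 < Λ := by linarith
  set b := r / ρ with hb
  have hb0 : 0 < b := by positivity
  have hrb : r = ρ * b := by rw [hb]; field_simp
  have hb2 : b ≤ 2 := by rw [hb, div_le_iff₀ hρ]; exact hr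
  -- Many rows: the children fill a planar region, and `s ≤ 2` suffices.
  have hA : b * b ≤ 2 * b ^ s := by
    have h1 : b * b = b ^ s * b ^ (2 - s) := by
      rw [← Real.rpow_add hb0, add_sub_cancel, Real.rpow_two, sq]
    have h2 : b ^ (2 - s) ≤ 2 := by
      calc b ^ (2 - s) ≤ 2 ^ (2 - s) := Real.rpow_le_rpow hb0.le hb2 (by linarith)
        _ ≤ 2 ^ (1 : ℝ) := Real.rpow_le_rpow_of_exponent_le (by norm_num) (by linarith)
        _ = 2 := Real.rpow_one 2
    rw [h1, mul_comm (2 : ℝ)]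
    gcongr
  -- Few rows: the count is linear in `r`, and the lower bound on `ρ` compensates; the worst case is
  -- `r` comparable to the gap `d`.
  have hB : b * (20 / ρ) ≤ b ^ s := by
    have h1 : b ^ s = b * b ^ (s - 1) := by
      rw [Real.rpow_sub hb0, Real.rpow_one]; field_simp
    have h2 : 1 / (4 * Λ) ≤ b := by
      rw [hb, div_le_div_iff₀ (by positivity) hρ]
      rw [div_le_iff₀ (by positivity)] at hd'
      nlinarith
    have h3 : 20 / ρ ≤ b ^ (s - 1) := by
      calc 20 / ρ ≤ 1 / (4 * Λ ^ (s - 1)) := by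
            rw [div_le_div_iff₀ hρ (by positivity)]; linarith
        _ ≤ 1 / (4 ^ (s - 1) * Λ ^ (s - 1)) := by
            gcongr
            calc (4 : ℝ) ^ (s - 1) ≤ 4 ^ (1 : ℝ) :=
                  Real.rpow_le_rpow_of_exponent_le (by norm_num) (by linarith)
              _ = 4 := Real.rpow_one 4
        _ = (1 / (4 * Λ)) ^ (s - 1) := by
            rw [Real.div_rpow (by norm_num) (by positivity), Real.one_rpow,
              Real.mul_rpow (by norm_num) hΛ0.le]
        _ ≤ b ^ (s - 1) := Real.rpow_le_rpow (by positivity) h2 (by linarith)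
    rw [h1]
    gcongr
  have hbs : 0 < b ^ s := by positivity
  have hρs : 0 < ρ ^ s := by positivity
  have hfirst : r / d + 2 ≤ 10 * Λ * b := by
    have h1 : 2 ≤ 4 * (r / d) := by
      have : 1 / 2 ≤ r / d := by rw [le_div_iff₀ hd]; linarith
      linarith
    have h2 : r / d ≤ 2 * Λ * b := by
      rw [div_le_iff₀ hd, hrb]
      rw [div_le_iff₀ (by positivity)] at hd'
      nlinarith
    linarith
  have hsecond : b * (r + 2) ≤ 4 * ρ * b ^ s := by
    have h1 : b * (20 / ρ) * ρ = 20 * b := by field_simp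
    have h2 : b * (20 / ρ) * ρ ≤ b ^ s * ρ := by gcongr
    have h3 : ρ * (b * b) ≤ ρ * (2 * b ^ s) := by gcongr
    rw [hrb]
    linarith
  calc (r / d + 2) * (r + 2) * (ρ ^ s / 3200)
      ≤ (10 * Λ * b) * (r + 2) * (ρ ^ s / 3200) := by gcongr
    _ = 10 * Λ * (b * (r + 2)) * (ρ ^ s / 3200) := by ring
    _ ≤ 10 * Λ * (4 * ρ * b ^ s) * (ρ ^ s / 3200) := by gcongr
    _ = Λ * ρ / 80 * (ρ ^ s * b ^ s) := by ring
    _ = Λ * ρ / 80 * r ^ s := by rw [hrb, Real.mul_rpow hρ.le hb0.le]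
    _ ≤ N * r ^ s := by gcongr

/-! ### Inverse branches of a node and their separation. -/

/-- The inverse branches belonging to the children of a node. -/
noncomputable def childMap (g : ℂ → ℂ) (a ρ : ℝ) (K : ℕ) (x : ℕ → ℝ) (i : ℕ) (w : ℂ) : ℂ :=
  {w : ℂ | a < w.re}.indicator g w + 2 * Real.pi *
    ((⌈(-(ρ / 2) - (g (x (i / K))).im) / (2 * Real.pi)⌉ + (i % K : ℕ) : ℝ) : ℂ) * Complex.I

/-- The image of the centre of a child. -/
noncomputable def childCenter (g : ℂ → ℂ) (ρ : ℝ) (K : ℕ) (x : ℕ → ℝ) (i : ℕ) : ℂ :=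
  g (x (i / K)) + 2 * Real.pi *
    ((⌈(-(ρ / 2) - (g (x (i / K))).im) / (2 * Real.pi)⌉ + (i % K : ℕ) : ℝ) : ℂ) * Complex.I

/-- Cutting `g` off outside the half-plane makes the branch measurable on all of `ℂ`. -/
lemma measurable_childMap {g : ℂ → ℂ} {a p : ℝ} (hg : IsTractLog g a p) (ρ : ℝ) (K : ℕ)
    (x : ℕ → ℝ) (i : ℕ) : Measurable (childMap g a ρ K x i) := by
  classical
  refine Measurable.add_const ?_ _
  rw [← Set.piecewise_eq_indicator]
  exact hg.differentiableOn.continuousOn.measurable_piecewise continuousOn_const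
    (isOpen_re_gt a).measurableSet

lemma exp_childMap {g : ℂ → ℂ} {a ρ : ℝ} {K : ℕ} {x : ℕ → ℝ} {i : ℕ} {w : ℂ} (hw : a < w.re) :
    Complex.exp (childMap g a ρ K x i w) = Complex.exp (g w) := by
  rw [childMap, indicator_of_mem (show w ∈ {w : ℂ | a < w.re} from hw)]
  rw [Complex.exp_eq_exp_iff_exists_int]
  refine ⟨⌈(-(ρ / 2) - (g (x (i / K))).im) / (2 * Real.pi)⌉ + (i % K : ℕ), ?_⟩
  simp only [Int.cast_add, Int.cast_natCast, Complex.ofReal_add, Complex.ofReal_intCast,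
    Complex.ofReal_natCast]
  ring

lemma re_childCenter {g : ℂ → ℂ} {ρ : ℝ} {K : ℕ} {x : ℕ → ℝ} {i : ℕ} :
    (childCenter g ρ K x i).re = (g (x (i / K))).re := by
  rw [childCenter, ← Complex.ofReal_ofNat, ← Complex.ofReal_mul, ← Complex.ofReal_mul,
    Complex.add_re, Complex.re_ofReal_mul, Complex.I_re, mul_zero, add_zero]

lemma im_childCenter {g : ℂ → ℂ} {ρ : ℝ} {K : ℕ} {x : ℕ → ℝ} {i : ℕ} :
    (childCenter g ρ K x i).im = (g (x (i / K))).im + 2 * Real.pi *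
      (⌈(-(ρ / 2) - (g (x (i / K))).im) / (2 * Real.pi)⌉ + (i % K : ℕ) : ℝ) := by
  rw [childCenter, ← Complex.ofReal_ofNat, ← Complex.ofReal_mul, ← Complex.ofReal_mul,
    Complex.add_im, Complex.im_ofReal_mul, Complex.I_im, mul_one]

/-- The ceiling picks the lowest translate with imaginary part at least `-ρ / 2`, and `K ≤ ρ / 10`
rows of spacing `2π < 10` end below `ρ / 2`. -/
lemma abs_im_childCenter_le {g : ℂ → ℂ} {ρ : ℝ} {K : ℕ} {x : ℕ → ℝ} {i : ℕ} (hK : 0 < K)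
    (hKρ : (K : ℝ) ≤ ρ / 10) : |(childCenter g ρ K x i).im| ≤ ρ / 2 := by
  rw [im_childCenter]
  set t := (g (x (i / K))).im
  have hπ := Real.pi_pos
  have h1 := Int.le_ceil ((-(ρ / 2) - t) / (2 * Real.pi))
  have h2 := (Int.ceil_lt_add_one ((-(ρ / 2) - t) / (2 * Real.pi))).le
  set m : ℝ := (⌈(-(ρ / 2) - t) / (2 * Real.pi)⌉ : ℝ)
  rw [div_le_iff₀ (by positivity)] at h1
  rw [← sub_le_iff_le_add, le_div_iff₀ (by positivity)] at h2
  have h3 : ((i % K : ℕ) : ℝ) + 1 ≤ K := by exact_mod_cast Nat.mod_lt i hK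
  have h4 : (0 : ℝ) ≤ (i % K : ℕ) := Nat.cast_nonneg _
  have h5 : 2 * Real.pi * ((i % K : ℕ) + 1 : ℝ) ≤ 2 * Real.pi * (ρ / 10) := by
    gcongr; linarith
  have h6 : 0 ≤ 2 * Real.pi * ((i % K : ℕ) : ℝ) := by positivity
  have hρ : 0 ≤ ρ := by
    have : (0 : ℝ) ≤ K := Nat.cast_nonneg _
    linarith
  have h7 : 2 * Real.pi * (ρ / 10) ≤ ρ := by nlinarith [Real.pi_lt_d2]
  rw [abs_le]
  constructor <;> nlinarith

namespace IsTractLog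

variable {g : ℂ → ℂ} {a p s X₀ : ℝ}

lemma node_subset (hX₀ : IsThreshold g a p s X₀) (hg : IsTractLog g a p) {X ρ : ℝ}
    (h : IsNode X₀ p s X ρ) :
    Metric.closedBall (X : ℂ) ρ ⊆ Metric.ball (X : ℂ) (X / 2) :=
  (Metric.closedBall_subset_closedBall h.radius_le).trans
    (hg.closedBall_subset (hX₀ X h.le_center).1)

lemma mem_halfPlane_of_mem_node (hX₀ : IsThreshold g a p s X₀) (hg : IsTractLog g a p) {X ρ : ℝ}
    (h : IsNode X₀ p s X ρ) {w : ℂ} (hw : w ∈ Metric.closedBall (X : ℂ) ρ) :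
    w ∈ {w : ℂ | a < w.re} :=
  ball_subset (hX₀ X h.le_center).1 (node_subset hX₀ hg h hw)

variable {X ρ : ℝ} {n K : ℕ} {x y : ℕ → ℝ} {d : ℝ}

lemma childMap_sub_childMap (hg : IsTractLog g a p) (hX₀ : IsThreshold g a p s X₀)
    (hc : IsChildren g p s X₀ X ρ n K x y d) (i : ℕ) {w w' : ℂ}
    (hw : w ∈ Metric.closedBall (x (i / K) : ℂ) (y (i / K)))
    (hw' : w' ∈ Metric.closedBall (x (i / K) : ℂ) (y (i / K))) :
    childMap g a ρ K x i w - childMap g a ρ K x i w' = g w - g w' := by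
  have h1 := (hc.child (i / K)).1
  rw [childMap, childMap, indicator_of_mem (mem_halfPlane_of_mem_node hX₀ hg h1 hw),
    indicator_of_mem (mem_halfPlane_of_mem_node hX₀ hg h1 hw')]
  ring

lemma norm_childMap_sub_le (hg : IsTractLog g a p) (hX₀ : IsThreshold g a p s X₀)
    (hc : IsChildren g p s X₀ X ρ n K x y d) (i : ℕ) {w w' : ℂ}
    (hw : w ∈ Metric.closedBall (x (i / K) : ℂ) (y (i / K)))
    (hw' : w' ∈ Metric.closedBall (x (i / K) : ℂ) (y (i / K))) :
    ‖childMap g a ρ K x i w - childMap g a ρ K x i w'‖ ≤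
      3 / 2 * ‖deriv g (x (i / K))‖ * ‖w - w'‖ := by
  obtain ⟨h1, -, -, h2, -⟩ := hc.child (i / K)
  rw [childMap_sub_childMap hg hX₀ hc i hw hw']
  exact hg.norm_sub_le (hX₀ _ h1.le_center).1 h2
    (Metric.closedBall_subset_closedBall h1.radius_le hw)
    (Metric.closedBall_subset_closedBall h1.radius_le hw')

lemma le_norm_childMap_sub (hg : IsTractLog g a p) (hX₀ : IsThreshold g a p s X₀)
    (hc : IsChildren g p s X₀ X ρ n K x y d) (i : ℕ) {w w' : ℂ}
    (hw : w ∈ Metric.closedBall (x (i / K) : ℂ) (y (i / K)))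
    (hw' : w' ∈ Metric.closedBall (x (i / K) : ℂ) (y (i / K))) :
    1 / 2 * ‖deriv g (x (i / K))‖ * ‖w - w'‖ ≤
      ‖childMap g a ρ K x i w - childMap g a ρ K x i w'‖ := by
  obtain ⟨h1, -, -, h2, -⟩ := hc.child (i / K)
  rw [childMap_sub_childMap hg hX₀ hc i hw hw']
  exact hg.le_norm_sub (hX₀ _ h1.le_center).1 h2
    (Metric.closedBall_subset_closedBall h1.radius_le hw)
    (Metric.closedBall_subset_closedBall h1.radius_le hw')

/-- Images of child discs are small compared with the column gap `d`, so separation can be tested on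
their centres. -/
lemma deriv_mul_radius_le (hρ : 0 < ρ) (hX : 1 ≤ X)
    (hc : IsChildren g p s X₀ X ρ n K x y d) (j : ℕ) :
    3 / 2 * ‖deriv g (x j)‖ * y j ≤ d / 8 := by
  obtain ⟨-, -, -, -, h, -⟩ := hc.child j
  have h1 := hc.le_sep
  have hΛ : 0 < (2 * X) ^ p := Real.rpow_pos_of_pos (by linarith) p
  have h2 : ρ / (4 * (2 * X) ^ p) = 1 / 2 * (ρ / (2 * (2 * X) ^ p)) := by field_simp; norm_num
  have h3 : 0 < ρ / (2 * (2 * X) ^ p) := by positivity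
  rw [mul_assoc, h, h2]
  nlinarith [distortionRadius_le, distortionRadius_pos]

lemma norm_childMap_sub_childCenter_le (hg : IsTractLog g a p) (hX₀ : IsThreshold g a p s X₀)
    (hρ : 0 < ρ) (hX : 1 ≤ X)
    (hc : IsChildren g p s X₀ X ρ n K x y d) (i : ℕ) {w : ℂ}
    (hw : w ∈ Metric.closedBall (x (i / K) : ℂ) (y (i / K))) :
    ‖childMap g a ρ K x i w - childCenter g ρ K x i‖ ≤ d / 8 := by
  obtain ⟨h1, -, hy, -⟩ := hc.child (i / K)
  have hx := Metric.mem_closedBall_self (x := (x (i / K) : ℂ)) hy.le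
  have h2 : childCenter g ρ K x i = childMap g a ρ K x i (x (i / K)) := by
    rw [childMap, indicator_of_mem (mem_halfPlane_of_mem_node hX₀ hg h1 hx), childCenter]
  rw [h2]
  refine (norm_childMap_sub_le hg hX₀ hc i hw hx).trans ?_
  refine le_trans ?_ (deriv_mul_radius_le hρ hX hc (i / K))
  rw [mem_closedBall_iff_norm] at hw
  gcongr

lemma mapsTo_childMap (hg : IsTractLog g a p) (hX₀ : IsThreshold g a p s X₀)
    (hρ : 1 ≤ ρ) (hX : 1 ≤ X) (hc : IsChildren g p s X₀ X ρ n K x y d) (i : ℕ) :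
    MapsTo (childMap g a ρ K x i) (Metric.closedBall (x (i / K) : ℂ) (y (i / K)))
      (Metric.closedBall (X : ℂ) ρ) := by
  intro w hw
  have h1 := norm_childMap_sub_childCenter_le hg hX₀ (by linarith) hX hc i hw
  have h2 := abs_im_childCenter_le (g := g) (x := x) (i := i) (by have := hc.two_le; omega)
    hc.le_div
  obtain ⟨-, -, -, -, -, h3, h4⟩ := hc.child (i / K)
  rw [← re_childCenter (g := g) (ρ := ρ)] at h3 h4
  set z := childCenter g ρ K x i
  -- The centre lies in a square of side `ρ` about `X`, and `1 / √2 < 3 / 4`.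
  have h5 : ‖z - X‖ ≤ 3 / 4 * ρ := by
    rw [← abs_of_nonneg (norm_nonneg (z - X)), ← abs_of_nonneg (by linarith : 0 ≤ 3 / 4 * ρ),
      ← sq_le_sq, Complex.sq_norm, Complex.normSq_apply, Complex.sub_re, Complex.sub_im,
      Complex.ofReal_re, Complex.ofReal_im, sub_zero]
    have h6 := abs_le.1 h2
    nlinarith
  rw [mem_closedBall_iff_norm]
  calc ‖childMap g a ρ K x i w - X‖ = ‖(childMap g a ρ K x i w - z) + (z - X)‖ := by ring_nf
    _ ≤ _ := norm_add_le _ _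
    _ ≤ d / 8 + 3 / 4 * ρ := add_le_add h1 h5
    _ ≤ ρ := by linarith [hc.sep_le]

/-- Children whose images are close to each other are few. -/
lemma card_le_of_norm_childCenter_sub_le (hc : IsChildren g p s X₀ X ρ n K x y d)
    {F : Finset ℕ} {r : ℝ} (hF : ∀ i ∈ F, i < n * K) (hF2 : 2 ≤ F.card)
    (hr : ∀ i ∈ F, ∀ j ∈ F, ‖childCenter g ρ K x i - childCenter g ρ K x j‖ ≤ r + d / 4) :
    d / 2 ≤ r ∧ (F.card : ℝ) ≤ (r / d + 2) * (r + 2) := by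
  classical
  have hK : 0 < K := by have := hc.two_le; omega
  have hd := hc.sep_pos
  have hd1 := hc.sep_le
  -- Different columns are separated by real parts, different rows of one column by imaginary parts.
  have hcol : ∀ i ∈ F, ∀ j ∈ F, i / K < j / K →
      d * (2 * ((j / K : ℕ) - (i / K : ℕ) : ℝ) - 1) ≤ r + d / 4 := by
    intro i hi j hj hij
    obtain ⟨k, hk⟩ := Nat.exists_eq_add_of_lt hij
    have h1 := hc.sep (i / K) (k + 1) (by
      rw [← add_assoc, ← hk]
      exact (Nat.div_lt_iff_lt_mul hK).2 (hF j hj))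
    rw [← add_assoc, ← hk] at h1
    have h2 := hr j hj i hi
    have h3 := (Complex.re_le_norm _).trans h2
    rw [Complex.sub_re, re_childCenter, re_childCenter] at h3
    rw [hk]
    push_cast at h1 ⊢
    have h4 : ((i / K : ℕ) : ℝ) + k + 1 - (i / K : ℕ) = k + 1 := by ring
    rw [h4]
    linarith
  have hrow : ∀ i ∈ F, ∀ j ∈ F, i / K = j / K → 2 * Real.pi * ((j : ℝ) - i) ≤ r + d / 4 := by
    intro i hi j hj hij
    have h3 := (Complex.im_le_norm _).trans (hr j hj i hi)
    rw [Complex.sub_im, im_childCenter, im_childCenter, hij] at h3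
    have hi' : (i : ℝ) = K * (j / K : ℕ) + (i % K : ℕ) := by
      rw [← hij]; exact_mod_cast (Nat.div_add_mod i K).symm
    have hj' : (j : ℝ) = K * (j / K : ℕ) + (j % K : ℕ) := by
      exact_mod_cast (Nat.div_add_mod j K).symm
    rw [hi', hj']
    linarith
  have hπ := Real.pi_gt_three
  have hr2 : d / 2 ≤ r := by
    obtain ⟨i, hi, j, hj, hij⟩ := Finset.one_lt_card.1 (by omega : 1 < F.card)
    have key : ∀ i ∈ F, ∀ j ∈ F, i / K < j / K → d / 2 ≤ r := by
      intro i hi j hj h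
      have h1 := hcol i hi j hj h
      have h2 : ((i / K : ℕ) : ℝ) + 1 ≤ (j / K : ℕ) := by exact_mod_cast h
      nlinarith
    have key' : ∀ i ∈ F, ∀ j ∈ F, i / K = j / K → i < j → d / 2 ≤ r := by
      intro i hi j hj h h'
      have h1 := hrow i hi j hj h
      have h2 : (i : ℝ) + 1 ≤ j := by exact_mod_cast h'
      nlinarith
    rcases lt_trichotomy (i / K) (j / K) with h | h | h
    · exact key i hi j hj h
    · rcases lt_or_gt_of_ne hij with h' | h'
      · exact key' i hi j hj h h'
      · exact key' j hj i hi h.symm h'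
    · exact key j hj i hi h
  have hr0 : 0 ≤ r := by linarith
  refine ⟨hr2, ?_⟩
  have h1 : F.card ≤ ⌊r + 2⌋₊ * (F.image (· / K)).card := by
    apply Finset.card_le_mul_card_image
    intro c hcm
    apply Nat.le_floor
    have : ((F.filter fun i => i / K = c).card : ℝ) ≤ (r + 1) + 1 := by
      apply card_le_of_forall_sub_le (by linarith)
      intro i hi j hj
      rw [Finset.mem_filter] at hi hj
      have h2 := hrow i hi.1 j hj.1 (hi.2.trans hj.2.symm)
      by_contra! h3
      nlinarith
    linarith
  have h2 : ((F.image (· / K)).card : ℝ) ≤ (r / d + 1) + 1 := by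
    apply card_le_of_forall_sub_le (by positivity)
    intro i hi j hj
    rw [Finset.mem_image] at hi hj
    obtain ⟨i', hi', rfl⟩ := hi
    obtain ⟨j', hj', rfl⟩ := hj
    rcases lt_or_ge (i' / K) (j' / K) with h | h
    · have h3 := hcol i' hi' j' hj' h
      have h4 : r = d * (r / d) := by field_simp
      have h5 : 0 ≤ r / d := by positivity
      rw [h4] at h3
      have h6 : d * (2 * ((j' / K : ℕ) - (i' / K : ℕ) : ℝ) - 1) ≤ d * (r / d + 1 / 4) := by
        linarith
      have := le_of_mul_le_mul_left h6 hd
      linarith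
    · have h3 : ((j' / K : ℕ) : ℝ) ≤ (i' / K : ℕ) := by exact_mod_cast h
      have : 0 ≤ r / d := by positivity
      linarith
  calc (F.card : ℝ) ≤ ((⌊r + 2⌋₊ * (F.image (· / K)).card : ℕ) : ℝ) := by exact_mod_cast h1
    _ = (⌊r + 2⌋₊ : ℝ) * ((F.image (· / K)).card : ℝ) := by push_cast; ring
    _ ≤ (r + 2) * (r / d + 1 + 1) := by
        gcongr
        exact Nat.floor_le (by linarith)
    _ = (r / d + 2) * (r + 2) := by ring

/-- All images lie in a disc of diameter `2ρ`, so `r` may be replaced by `min r (2 * ρ)`; passing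
from image points to centres costs `d / 8` twice. -/
lemma card_mul_le_mul_rpow (hg : IsTractLog g a p) (hX₀ : IsThreshold g a p s X₀) (hp : 1 ≤ p)
    (hs : 1 < s) (hs2 : s ≤ 2) (h : IsNode X₀ p s X ρ) (hc : IsChildren g p s X₀ X ρ n K x y d)
    (F : Finset ℕ) (r : ℝ) (hF : ∀ i ∈ F, i < n * K) (hF2 : 2 ≤ F.card)
    (hr : ∀ i ∈ F, ∀ j ∈ F, ∃ w ∈ Metric.closedBall (x (i / K) : ℂ) (y (i / K)),
      ∃ w' ∈ Metric.closedBall (x (j / K) : ℂ) (y (j / K)),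
        ‖childMap g a ρ K x i w - childMap g a ρ K x j w'‖ ≤ r) :
    F.card * (ρ ^ s / 3200) ≤ (n * K : ℝ) * r ^ s := by
  have hX1 := (hX₀ X h.le_center).2.1
  obtain ⟨h80, hρ80⟩ := h.eighty_le hX1 hp hs
  obtain ⟨hr1, hr2⟩ := card_le_of_norm_childCenter_sub_le hc (r := min r (2 * ρ)) hF hF2 (by
    intro i hi j hj
    obtain ⟨w, hw, w', hw', hww⟩ := hr i hi j hj
    have h1 := norm_childMap_sub_childCenter_le hg hX₀ (by linarith) hX1 hc i hw
    have h2 := norm_childMap_sub_childCenter_le hg hX₀ (by linarith) hX1 hc j hw'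
    have h3 := mapsTo_childMap hg hX₀ (by linarith) hX1 hc i hw
    have h4 := mapsTo_childMap hg hX₀ (by linarith) hX1 hc j hw'
    rw [mem_closedBall_iff_norm] at h3 h4
    set u := childMap g a ρ K x i w
    set u' := childMap g a ρ K x j w'
    set z := childCenter g ρ K x i
    set z' := childCenter g ρ K x j
    have h5 : ‖u - u'‖ ≤ min r (2 * ρ) := by
      refine le_min hww ?_
      calc ‖u - u'‖ = ‖(u - X) - (u' - X)‖ := by ring_nf
        _ ≤ _ := _root_.norm_sub_le _ _
        _ ≤ 2 * ρ := by linarith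
    calc ‖z - z'‖ = ‖(u - u') - (u - z) + (u' - z')‖ := by ring_nf
      _ ≤ ‖u - u'‖ + ‖u - z‖ + ‖u' - z'‖ :=
          (norm_add_le _ _).trans (add_le_add_left (_root_.norm_sub_le _ _) _)
      _ ≤ min r (2 * ρ) + d / 4 := by linarith)
  have hΛ : 1 ≤ (2 * X) ^ p := Real.one_le_rpow (by linarith) (by linarith)
  have hpow : ((2 * X) ^ p) ^ (s - 1) = (2 * X) ^ (p * (s - 1)) :=
    (Real.rpow_mul (by linarith) _ _).symm
  have hd := hc.sep_pos
  have hmain := mul_mul_rpow_le hΛ (by linarith) hs hs2 (by rw [hpow]; exact h80) hc.le_mul hd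
    hc.le_sep hr1 (min_le_right _ _)
  have hρs : 0 ≤ ρ ^ s := Real.rpow_nonneg (by linarith) s
  calc F.card * (ρ ^ s / 3200) ≤ (min r (2 * ρ) / d + 2) * (min r (2 * ρ) + 2) * (ρ ^ s / 3200) := by
        gcongr
    _ ≤ (n * K : ℝ) * min r (2 * ρ) ^ s := hmain
    _ ≤ (n * K : ℝ) * r ^ s := by
        gcongr
        · linarith
        · exact min_le_left _ _

end IsTractLog

/-! ### The tree in the tract and the conclusion. -/

/-- The points having an infinite backward orbit escaping to the right under the inverse branches
`g + 2πik` form a set of large Hausdorff dimension. -/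
theorem IsTractLog.exists_le_dimH {g : ℂ → ℂ} {a p s : ℝ} (hg : IsTractLog g a p) (hp : 1 ≤ p)
    (hs : 1 < s) (hps : p * (s - 1) < 1) :
    ∃ K : Set ℂ, ENNReal.ofReal s ≤ dimH K ∧ ∀ z ∈ K, ∃ w : ℕ → ℂ, w 0 = z ∧
      (∀ n, a < (w n).re ∧ Complex.exp (w n) = Complex.exp (g (w (n + 1)))) ∧
      Tendsto (fun n => (w n).re) atTop atTop := by
  obtain ⟨X₀, hX₀'⟩ := exists_threshold a p (p * (s - 1))
    (g (Real.exp (Real.log (2 * a)) : ℝ)).re (2 ^ (p * (s - 1)) * (5376 / distortionRadius)) hp hps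
  have hX₀ : IsThreshold g a p s X₀ := hX₀'
  have hκ := distortionRadius_pos
  have hs2 : s ≤ 2 := by nlinarith
  -- A root exists because `X` outgrows `X^(p(s-1))`.
  obtain ⟨X₁, hX₁⟩ : ∃ X, IsNode X₀ p s X (distortionRadius * X) := by
    have h1 : Tendsto (fun X : ℝ => (2 * X) ^ (1 - p * (s - 1))) atTop atTop :=
      (tendsto_rpow_atTop (by linarith)).comp (tendsto_id.const_mul_atTop (by norm_num))
    obtain ⟨X, h2, h3, h4⟩ := ((h1.eventually_ge_atTop
      (2 / distortionRadius * (80 * (8 / distortionRadius) ^ s))).and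
      ((eventually_ge_atTop X₀).and (eventually_gt_atTop 0))).exists
    refine ⟨X, h3, ?_, le_rfl⟩
    have h5 : (2 * X) ^ (p * (s - 1)) * (2 * X) ^ (1 - p * (s - 1)) = 2 * X := by
      rw [← Real.rpow_add (by linarith), add_sub_cancel, Real.rpow_one]
    have h6 : 0 < (2 * X) ^ (p * (s - 1)) := Real.rpow_pos_of_pos (by linarith) _
    calc 80 * (8 / distortionRadius) ^ s * (2 * X) ^ (p * (s - 1))
        = distortionRadius / 2 * ((2 * X) ^ (p * (s - 1)) *
            (2 / distortionRadius * (80 * (8 / distortionRadius) ^ s))) := by field_simp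
      _ ≤ distortionRadius / 2 *
          ((2 * X) ^ (p * (s - 1)) * (2 * X) ^ (1 - p * (s - 1))) := by gcongr
      _ = distortionRadius * X := by rw [h5]; ring
  let S := {x : ℝ × ℝ // IsNode X₀ p s x.1 x.2}
  choose n K x y d hc using fun σ : S => hg.exists_children hp hs hX₀ σ.2
  have hX1 : ∀ σ : S, 1 ≤ σ.1.1 := fun σ => (hX₀ _ σ.2.le_center).2.1
  have hρ80 : ∀ σ : S, 80 ≤ σ.1.2 := fun σ => (σ.2.eighty_le (hX1 σ) hp hs).2
  let T : DiscTree S :=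
    { center := fun σ => (σ.1.1 : ℂ)
      radius := fun σ => σ.1.2
      num := fun σ => n σ * K σ
      child := fun σ i => ⟨(x σ (i / K σ), y σ (i / K σ)), ((hc σ).child _).1⟩
      map := fun σ i => childMap g a σ.1.2 (K σ) (x σ) i
      radius_pos := fun σ => by linarith [hρ80 σ]
      two_le_num := fun σ => le_trans (hc σ).two_le (Nat.le_mul_of_pos_left _ (hc σ).num_pos)
      measurable_map := fun σ i => measurable_childMap hg _ _ _ _
      mapsTo := fun σ i _ => mapsTo_childMap hg hX₀ (by linarith [hρ80 σ]) (hX1 σ) (hc σ) i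
      lipschitz := fun σ i _ => ⟨3 / 2 * ‖deriv g (x σ (i / K σ))‖, by positivity,
        (deriv_mul_radius_le (by linarith [hρ80 σ]) (hX1 σ) (hc σ) _).trans
          (by linarith [(hc σ).sep_le, hρ80 σ]),
        fun w hw w' hw' => norm_childMap_sub_le hg hX₀ (hc σ) i hw hw'⟩ }
  have hT := T.le_dimH_limitSet (s := s) (by linarith)
    (fun σ i => 1 / 2 * ‖deriv g (x σ (i / K σ))‖) (fun σ => σ.1.2 ^ s / 3200)
    (fun σ => by have := hρ80 σ; positivity)
    (fun σ i _ => by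
      have := norm_pos_iff.2 ((hc σ).child (i / K σ)).2.2.2.1
      positivity)
    (fun σ i _ w hw w' hw' => le_norm_childMap_sub hg hX₀ (hc σ) i hw hw')
    (fun σ i _ => by
      obtain ⟨-, -, hy, -, hD, -⟩ := (hc σ).child (i / K σ)
      have hX := hX1 σ
      have h1 := rpow_le_mul_rpow (Λ := (2 * σ.1.1) ^ p) (N := n σ * K σ) (s := s) hκ
        (Real.rpow_pos_of_pos (by linarith) p) (by linarith [hρ80 σ] : 0 < σ.1.2)
        (by rw [← Real.rpow_mul (by linarith)]; exact σ.2.le_radius) (hc σ).le_mul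
      have h2 : distortionRadius * (σ.1.2 / (8 * (2 * σ.1.1) ^ p)) =
          1 / 2 * ‖deriv g (x σ (i / K σ))‖ * y σ (i / K σ) := by
        have h3 : 0 < (2 * σ.1.1) ^ p := Real.rpow_pos_of_pos (by linarith) p
        rw [mul_assoc, hD]
        field_simp
        ring
      rw [h2, Real.mul_rpow (by positivity) hy.le] at h1
      change σ.1.2 ^ s / 3200 ≤ ((n σ * K σ : ℕ) : ℝ) *
        (1 / 2 * ‖deriv g (x σ (i / K σ))‖) ^ s * (y σ (i / K σ) ^ s / 3200)
      push_cast
      linarith)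
    (fun σ F r hF hF2 hr => by
      have := card_mul_le_mul_rpow hg hX₀ hp hs hs2 σ.2 (hc σ) F r hF hF2 hr
      change _ ≤ ((n σ * K σ : ℕ) : ℝ) * r ^ s
      push_cast
      exact this)
    ⟨(X₁, distortionRadius * X₁), hX₁⟩
  refine ⟨_, hT, ?_⟩
  rintro z ⟨τ, i, w, hτ0, hw0, hw⟩
  have hre : ∀ m, a < (w m).re := fun m =>
    mem_halfPlane_of_mem_node hX₀ hg (τ m).2 (hw m).2.2.1
  refine ⟨w, hw0, fun m => ⟨hre m, ?_⟩, ?_⟩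
  · have h1 := (hw m).2.2.2
    rw [h1]
    exact exp_childMap (hre (m + 1))
  -- Each child centre exceeds its parent's by at least 1, and points of a node have real part at
  -- least half the centre.
  · have hcen : ∀ m : ℕ, (m : ℝ) ≤ (τ m).1.1 := by
      intro m
      induction m with
      | zero => simpa using (by linarith [hX1 (τ 0)] : (0 : ℝ) ≤ (τ 0).1.1)
      | succ m ih =>
        have h1 := (hw m).2.1
        have h2 : (τ (m + 1)).1.1 = x (τ m) (i m / K (τ m)) := by rw [h1]
        have h3 := ((hc (τ m)).child (i m / K (τ m))).2.1
        rw [h2]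
        push_cast
        linarith
    refine tendsto_atTop_mono (fun m => ?_)
      (tendsto_natCast_atTop_atTop.atTop_div_const (by norm_num : (0 : ℝ) < 2))
    have h1 := node_subset hX₀ hg (τ m).2 (hw m).2.2.1
    rw [mem_ball_iff_norm'] at h1
    have h2 := (le_abs_self _).trans (Complex.abs_re_le_norm _) |>.trans h1.le
    rw [Complex.sub_re, Complex.ofReal_re] at h2
    linarith [hcen m]

/-- The exponential function does not decrease the Hausdorff dimension. -/
lemma dimH_le_dimH_image_exp (K : Set ℂ) : dimH K ≤ dimH (Complex.exp '' K) := by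
  -- On a strip of height 2 the exponential is undone by a rotated principal logarithm, smooth on a
  -- convex half-plane; countable stability of dimension does the rest.
  have hK : K = ⋃ m : ℤ, {w ∈ K | |w.im - m| ≤ 1} := by
    ext w
    simp only [mem_iUnion, mem_ofPred_eq]
    refine ⟨fun hw => ⟨⌊w.im⌋, hw, ?_⟩, fun ⟨_, hw, _⟩ => hw⟩
    rw [abs_le]
    constructor <;> linarith [Int.floor_le w.im, Int.lt_floor_add_one w.im]
  rw [hK, dimH_iUnion, ← hK]
  refine iSup_le fun m => ?_
  set H : Set ℂ := {z | 0 < (z * Complex.exp (-(m * Complex.I))).re} with hH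
  set F : ℂ → ℂ := fun z => Complex.log (z * Complex.exp (-(m * Complex.I))) + m * Complex.I
  have hF : ContDiffOn ℝ 1 F H := by
    refine ContDiffOn.add ?_ contDiffOn_const
    have h1 : ContDiffOn ℂ 1 (fun z => Complex.log (z * Complex.exp (-(m * Complex.I)))) H :=
      fun z hz => ((Complex.contDiffAt_log (Or.inl hz)).comp z
        (contDiffAt_id.mul contDiffAt_const)).contDiffWithinAt
    exact h1.restrict_scalars ℝ
  have hHc : Convex ℝ H := by
    have : H = (fun z : ℂ => z * Complex.exp (-(m * Complex.I))) ⁻¹' {w | 0 < w.re} := rfl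
    rw [this]
    exact (convex_re_gt 0).is_linear_preimage
      ⟨fun x y => add_mul _ _ _, fun c x => smul_mul_assoc _ _ _⟩
  have hexp : ∀ w : ℂ, Complex.exp w * Complex.exp (-(m * Complex.I)) =
      Complex.exp (w - m * Complex.I) := fun w => by rw [← Complex.exp_add, sub_eq_add_neg]
  have him : ∀ w : ℂ, (w - m * Complex.I).im = w.im - m := fun w => by simp
  have hπ := Real.pi_gt_three
  have hsub : Complex.exp '' {w ∈ K | |w.im - m| ≤ 1} ⊆ H := by
    rintro _ ⟨w, ⟨-, hw⟩, rfl⟩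
    rw [hH, mem_ofPred_eq, hexp, Complex.exp_re, him]
    have hw' := abs_le.1 hw
    exact mul_pos (Real.exp_pos _) (Real.cos_pos_of_mem_Ioo ⟨by linarith, by linarith⟩)
  have himage : {w ∈ K | |w.im - m| ≤ 1} ⊆ F '' (Complex.exp '' {w ∈ K | |w.im - m| ≤ 1}) := by
    intro w hw
    refine ⟨Complex.exp w, mem_image_of_mem _ hw, ?_⟩
    have hw' := abs_le.1 hw.2
    change Complex.log (Complex.exp w * _) + _ = w
    rw [hexp, Complex.log_exp (by rw [him]; linarith) (by rw [him]; linarith), sub_add_cancel]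
  calc dimH {w ∈ K | |w.im - m| ≤ 1} ≤ _ := dimH_mono himage
    _ ≤ dimH (Complex.exp '' {w ∈ K | |w.im - m| ≤ 1}) := hF.dimH_image_le hHc hsub
    _ ≤ dimH (Complex.exp '' K) := dimH_mono (image_mono fun w hw => hw.1)

/-- Points with an escaping orbit in logarithmic coordinates belong to `I(f, D)`. -/
lemma image_exp_subset_escapingSetIn {f g : ℂ → ℂ} {D K : Set ℂ} {a : ℝ}
    (hg : ∀ w : ℂ, a < w.re →
      Complex.exp (g w) ∈ D ∧ f (Complex.exp (g w)) = Complex.exp w)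
    (hK : ∀ z ∈ K, ∃ w : ℕ → ℂ, w 0 = z ∧
      (∀ n, a < (w n).re ∧ Complex.exp (w n) = Complex.exp (g (w (n + 1)))) ∧
      Tendsto (fun n => (w n).re) atTop atTop) :
    Complex.exp '' K ⊆ escapingSetIn f D := by
  rintro _ ⟨z, hz, rfl⟩
  obtain ⟨w, rfl, hw, hlim⟩ := hK z hz
  have hiter : ∀ n, f^[n] (Complex.exp (w 0)) = Complex.exp (w n) := by
    intro n
    induction n with
    | zero => rfl
    | succ n ih =>
      rw [Function.iterate_succ_apply', ih, (hw n).2, (hg _ (hw (n + 1)).1).2]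
  have hD : ∀ n, Complex.exp (w n) ∈ D := fun n => by
    rw [(hw n).2]
    exact (hg _ (hw (n + 1)).1).1
  refine ⟨hD 0, fun n => by rw [hiter]; exact hD n, ?_⟩
  simp only [hiter, Complex.norm_exp]
  exact Real.tendsto_exp_atTop.comp hlim

lemma IsLogarithmicTract.exists_isTractLog {f : ℂ → ℂ} {D : Set ℂ}
    (hD : IsLogarithmicTract f D) {p r : ℝ}
    (hr : ∀ z ∈ D, r ≤ ‖z‖ → ‖f z‖ ≤ Real.exp (Real.exp (Real.log ‖z‖ ^ p))) :
    ∃ (a : ℝ) (g : ℂ → ℂ), IsTractLog g a p ∧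
      ∀ w : ℂ, a < w.re → Complex.exp (g w) ∈ D ∧ f (Complex.exp (g w)) = Complex.exp w := by
  obtain ⟨a, g, hgd, hgi, hg⟩ := hD.exists_log_coordinate hr
  have hsub : {w : ℂ | max a 1 < w.re} ⊆ {w | a < w.re} := fun w hw =>
    (le_max_left a 1).trans_lt (show max a 1 < w.re from hw)
  exact ⟨max a 1, g, ⟨le_max_right _ _, hgd.mono hsub, hgi.mono hsub,
    fun w hw => (hg w (hsub hw)).2.2⟩, fun w hw => ⟨(hg w (hsub hw)).1, (hg w (hsub hw)).2.1⟩⟩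

theorem theorem2 (f : ℂ → ℂ) (D : Set ℂ) (q : ℝ) (hD : IsLogarithmicTract f D)
    (hgrowth : ∀ ε : ℝ, 0 < ε → ∃ r : ℝ, 0 < r ∧ ∀ z ∈ D, r ≤ ‖z‖ →
      ‖f z‖ ≤ Real.exp (Real.exp (Real.log ‖z‖ ^ (q + ε)))) :
    ENNReal.ofReal (1 + 1 / q) ≤ dimH (escapingSetIn f D) := by
  have htract : ∀ p > q, ∃ (a : ℝ) (g : ℂ → ℂ), IsTractLog g a p ∧
      ∀ w : ℂ, a < w.re → Complex.exp (g w) ∈ D ∧ f (Complex.exp (g w)) = Complex.exp w := by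
    intro p hp
    obtain ⟨r, -, hr⟩ := hgrowth (p - q) (sub_pos.2 hp)
    rw [add_sub_cancel] at hr
    exact hD.exists_isTractLog hr
  have hq : 1 ≤ q := by
    by_contra! hq
    obtain ⟨p, hp, hp1⟩ := exists_between (max_lt hq one_pos : max q 0 < 1)
    obtain ⟨a, g, hg, -⟩ := htract p ((le_max_left _ _).trans_lt hp)
    linarith [hg.one_le_exponent ((le_max_right _ _).trans_lt hp)]
  have hq0 : 0 < q := by linarith
  refine le_of_forall_lt_imp_le_of_dense fun b hb => ?_
  by_cases hbtop : b = ⊤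
  · simp [hbtop] at hb
  lift b to NNReal using hbtop
  have hb' : (b : ℝ) < 1 + 1 / q := by
    rwa [ENNReal.ofReal, ENNReal.coe_lt_coe, Real.lt_toNNReal_iff_coe_lt] at hb
  obtain ⟨s, hs, hs'⟩ := exists_between
    (max_lt hb' (by linarith [one_div_pos.2 hq0] : 1 < 1 + 1 / q))
  have hbs : (b : ℝ) < s := (le_max_left _ _).trans_lt hs
  have hs1 : 1 < s := (le_max_right _ _).trans_lt hs
  have hqs : q < 1 / (s - 1) := by
    rw [lt_div_iff₀ (by linarith)]
    have : s - 1 < 1 / q := by linarith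
    rwa [lt_div_iff₀ hq0, mul_comm] at this
  -- The inequality `s < 1 + 1/q` leaves room for `p > q` with `p (s - 1) < 1`.
  obtain ⟨p, hp, hp'⟩ := exists_between hqs
  obtain ⟨a, g, hg, hgD⟩ := htract p hp
  obtain ⟨K, hKdim, hK⟩ := hg.exists_le_dimH (by linarith) hs1
    (by rwa [lt_div_iff₀ (by linarith)] at hp')
  calc (b : ENNReal) = ENNReal.ofReal b := (ENNReal.ofReal_coe_nnreal).symm
    _ ≤ ENNReal.ofReal s := ENNReal.ofReal_le_ofReal hbs.le
    _ ≤ dimH K := hKdim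
    _ ≤ dimH (Complex.exp '' K) := dimH_le_dimH_image_exp K
    _ ≤ dimH (escapingSetIn f D) := dimH_mono (image_exp_subset_escapingSetIn hgD hK)
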